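/- Let $d\ge 1$, $N\ge 2$ and $1\le m\le N^d$ be integers and let $\alpha,\sigma>0$, $R\ge\alpha$ and $L$ be real numbers. Let $T_\pm$ be the set of tensors in $\{\pm1\}^{N\times\cdots\times N}$ (order $d$) of CP rank one. For an order-$d$ tensor $T\in\mathbb R^{N\times\cdots\times N}$ put $$\|T\|_M=\inf\{t>0: T\in t\,\mathrm{conv}(T_\pm)\},\qquad \|T\|_\infty=\max_\omega|T(\omega)|,\qquad \|T\|_F^2=\sum_\omega T(\omega)^2,$$ and let $K_M(\alpha,R)=\{T:\|T\|_\infty\le\alpha,\ \|T\|_M\le R\}$. Let $K_G$ be the real Grothendieck constant, i.e. the least $K$ such that for every real matrix $A=(a_{ij})$ with $|\sum_{i,j} a_{ij}s_it_j|\le 1$ for all $s_i,t_j\in[-1,1]$ one has $|\sum_{i,j}a_{ij}\langle x_i,y_j\rangle|\le K$ for all vectors $x_i,y_j$ in the unit ball of any finite-dimensional Euclidean space. Let $\Pi=(\pi_\omega)_{\omega\in[N]^d}$ be a probability distribution with $\max_\omega\pi_\omega\le L/N^d$. One observes $(\omega_t,Y_t)_{t=1}^m$ with $Y_t=T(\omega_t)+\sigma\xi_t$,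 where $\omega_1,\dots,\omega_m$ are i.i.d. with law $\Pi$, $\xi_1,\dots,\xi_m$ are i.i.d. standard normal, and the two families are independent. Assume $$R^2\ge\frac{48\,\alpha^2K_G^2}{N}.$$ Then $$\inf_{\hat T}\ \sup_{T\in K_M(\alpha,R)}\ \frac1{N^d}\,\mathbb E\|\hat T-T\|_F^2\ \ge\ \min\Big\{\frac{\alpha^2}{16},\ \frac{\sigma R}{128\sqrt2\,K_G}\sqrt{\frac{N}{mL}}\Big\},$$ where the infimum is over all measurable estimators $\hat T=\hat T\big((\omega_t,Y_t)_{t\le m}\big)$ with values in $\mathbb R^{N\times\cdots\times N}$. -/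

import Mathlib

open MeasureTheory ProbabilityTheory

noncomputable section

namespace TensorCompletion

/-- Order-`d` real tensors all of whose sizes equal `N`, with their entries indexed
by `ω = (i₁, …, i_d)`. -/
abbrev Tensor (d N : ℕ) : Type := (Fin d → Fin N) → ℝ

/-- The outer product `u₁ ∘ ⋯ ∘ u_d` of vectors. -/
def outer {d N : ℕ} (u : Fin d → Fin N → ℝ) : Tensor d N :=
  fun ω => ∏ j, u j (ω j)

/-- The CP rank: the least number of outer products of vectors that sum to `T`. -/
def cpRank {d N : ℕ} (T : Tensor d N) : ℕ :=
  sInf {r : ℕ | ∃ u : Fin r → Fin d → Fin N → ℝ, T = ∑ i, outer (u i)}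

/-- The set `T_±` of sign tensors of rank one. -/
def signTensors (d N : ℕ) : Set (Tensor d N) :=
  {T | (∀ ω, T ω = 1 ∨ T ω = -1) ∧ cpRank T = 1}

/-- The atomic M-norm `inf {t > 0 : T ∈ t conv(T_±)}`; this is the definition of `gauge`. -/
def mNorm {d N : ℕ} (T : Tensor d N) : ℝ :=
  gauge (convexHull ℝ (signTensors d N)) T

/-- `K_M(α, R)`: entries bounded by `α`, M-norm bounded by `R`. -/
def boundedMSet (d N : ℕ) (α R : ℝ) : Set (Tensor d N) :=
  {T | (∀ ω, |T ω| ≤ α) ∧ mNorm T ≤ R}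

/-- Squared Frobenius norm. -/
def frobeniusSq {d N : ℕ} (T : Tensor d N) : ℝ := ∑ ω, T ω ^ 2

/-- `K` is admissible in the real Grothendieck inequality. Vectors in a real Hilbert space
that are finite in number span a Euclidean space, so Euclidean spaces of all dimensions suffice. -/
def IsGrothendieckBound (K : ℝ) : Prop :=
  ∀ (p q k : ℕ) (A : Matrix (Fin p) (Fin q) ℝ),
    (∀ (s : Fin p → ℝ) (t : Fin q → ℝ), (∀ i, |s i| ≤ 1) → (∀ j, |t j| ≤ 1) →
      |∑ i, ∑ j, A i j * (s i * t j)| ≤ 1) →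
    ∀ (x : Fin p → EuclideanSpace ℝ (Fin k)) (y : Fin q → EuclideanSpace ℝ (Fin k)),
      (∀ i, ‖x i‖ ≤ 1) → (∀ j, ‖y j‖ ≤ 1) →
      |∑ i, ∑ j, A i j * inner ℝ (x i) (y j)| ≤ K

/-- The real Grothendieck constant `K_G`, the least admissible constant. -/
def grothendieckConstant : ℝ := sInf {K : ℝ | IsGrothendieckBound K}

/-- The law of one observation `(ω, Y)`, where `ω` has law `Π`, `ξ` is standard normal and
independent of `ω`, and `Y = T(ω) + σ ξ`. -/
def observationLaw {d N : ℕ} (P : PMF (Fin d → Fin N)) (σ : ℝ) (T : Tensor d N) :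
    Measure ((Fin d → Fin N) × ℝ) :=
  (P.toMeasure.prod (gaussianReal 0 1)).map (fun z => (z.1, T z.1 + σ * z.2))

/-- The law of the data: `m` independent observations (sampling with replacement). -/
def dataLaw {d N : ℕ} (m : ℕ) (P : PMF (Fin d → Fin N)) (σ : ℝ) (T : Tensor d N) :
    Measure (Fin m → (Fin d → Fin N) × ℝ) :=
  Measure.pi (fun _ => observationLaw P σ T)

/-- The normalized risk `N⁻ᵈ 𝔼 ‖T̂ - T‖_F²` of the estimator `est`, in `[0, ∞]`. -/
def risk {d N m : ℕ} (P : PMF (Fin d → Fin N)) (σ : ℝ)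
    (est : (Fin m → (Fin d → Fin N) × ℝ) → Tensor d N) (T : Tensor d N) : ENNReal :=
  ∫⁻ z, ENNReal.ofReal (frobeniusSq (est z - T) / (N : ℝ) ^ d) ∂(dataLaw m P σ T)

/-- The minimax risk over a class `S` of tensors: the infimum over all measurable estimators
of the worst-case risk over `S`. -/
def minimaxRisk {d N : ℕ} (m : ℕ) (P : PMF (Fin d → Fin N)) (σ : ℝ)
    (S : Set (Tensor d N)) : ENNReal :=
  ⨅ (est : (Fin m → (Fin d → Fin N) × ℝ) → Tensor d N) (_ : Measurable est),
    ⨆ T ∈ S, risk P σ est T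

end TensorCompletion

end

/-!
The lower bound comes from random tensors that are constant on blocks: `T ω = β * ±1`, with
independent signs attached to the fibres of a map `f` that acts on each index separately
(`blockTensor`).

**Estimation.** Two such tensors that differ only in the sign of one block have a Bayes risk at
each entry of the block that is explicit enough: given the sampled positions, `n` of which fall in
the block, the affinity of the two Gaussian laws is `exp (-n β² / (2 σ²))`, and averaging over the
positions gives `two_point_risk`. Assouad's argument over all blocks (`assouad_bound`) tolerates
that a quarter of the sign vectors is discarded. With Jensen's inequality the outcome is
`le_minimaxRisk_of_blocks`: the risk is at least `β² / 8` if the blocks are so small that the noise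
hides their signs, and also if they are single entries, since `m ≤ Nᵈ` samples miss a constant
fraction of them.

**M-norm.** By duality (`mNorm_le_of_dual`), a tensor is tested against forms `Φ` that are bounded
by one on rank-one sign tensors. All directions but two are contracted with independent random
product signs `X`. These are orthonormal functions of the randomness, so a tensor is the mean of
its contractions times `X` (`sum_contraction_mul`), and Grothendieck's inequality bounds `Φ` on
each contraction by `K_G` times its largest row length (`abs_sum_rows_le`). For random signs and `r`
blocks per row, every squared row length has mean `r`. Its variance is at most `2 r² / N`, so that
the `N` rows are controlled simultaneously, without a logarithmic factor, and the M-norm is at most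
`2 K_G β √r` for three quarters of the sign vectors (`card_compl_goodSigns`,
`mNorm_blockTensor_le`). Only one factor `K_G` appears, whatever the order of the tensor.

**Choice of the blocks.** There are about `r N` blocks, where any `r` between `1` and `Nᵈ⁻¹` is
available up to a factor two (`exists_block_counts`). One takes `β = min α (R / (2 K_G √r))` and `r`
of the order of `R / (K_G Q)`, where `Q = σ √(N / m)`, cut off at `1` and `Nᵈ⁻¹`
(`le_minimaxRisk`). At the lower end the tensors depend on the first index only, and their M-norm
is `β`.

That `K_G` is an admissible constant requires Grothendieck's inequality with some finite constant;
it is proved by truncating Rademacher sums (`isGrothendieckBound_ninetySix`).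
-/

namespace TensorCompletion

open scoped ENNReal NNReal Pointwise

/-! ### Products of measures with densities -/

theorem lintegral_fin_prod_eq_prod {n : ℕ} {E : Type*} [MeasurableSpace E]
    (μ : Measure E) [SigmaFinite μ] (f : Fin n → E → ℝ≥0∞) (hf : ∀ i, Measurable (f i)) :
    ∫⁻ x, ∏ i, f i (x i) ∂(Measure.pi fun _ => μ) = ∏ i, ∫⁻ x, f i x ∂μ := by
  induction n with
  | zero => simp [lintegral_const]
  | succ n ih =>
    have hm : ∀ i : Fin n, Measurable fun a : Fin n → E => f i.succ (a i) :=
      fun i => (hf _).comp (measurable_pi_apply i)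
    have hp := (measurePreserving_piFinSuccAbove (fun _ : Fin (n + 1) => μ) 0).symm
    have hm' : Measurable fun x : Fin (n + 1) → E => ∏ i, f i (x i) :=
      Finset.measurable_fun_prod _ fun i _ => (hf i).comp (measurable_pi_apply i)
    rw [← hp.lintegral_comp hm']
    have h1 : ∀ z : E × (Fin n → E),
        ∏ i, f i ((MeasurableEquiv.piFinSuccAbove (fun _ : Fin (n + 1) => E) 0).symm z i)
          = f 0 z.1 * ∏ i : Fin n, f i.succ (z.2 i) := by
      intro z
      rw [Fin.prod_univ_succ]
      rfl
    simp_rw [h1]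
    rw [lintegral_prod_mul (hf 0).aemeasurable
        (Finset.measurable_fun_prod _ fun i _ => hm i).aemeasurable, Fin.prod_univ_succ,
      ih (fun i => f i.succ) (fun i => hf _)]

/-- A product of identical measures with densities has the product of the densities as density. -/
theorem pi_withDensity {n : ℕ} {E : Type*} [MeasurableSpace E]
    (μ : Measure E) [SigmaFinite μ] (g : E → ℝ≥0∞) (hg : Measurable g)
    [SigmaFinite (μ.withDensity g)] :
    Measure.pi (fun _ : Fin n => μ.withDensity g)
      = (Measure.pi fun _ : Fin n => μ).withDensity (fun x => ∏ i, g (x i)) := by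
  refine Measure.pi_eq fun s hs => ?_
  have hind : ∀ x : Fin n → E, (Set.univ.pi s).indicator (fun x => ∏ i, g (x i)) x
      = ∏ i, (s i).indicator g (x i) := by
    intro x
    by_cases hx : x ∈ Set.univ.pi s
    · rw [Set.indicator_of_mem hx]
      exact Finset.prod_congr rfl fun i _ => (Set.indicator_of_mem (hx i trivial) _).symm
    · rw [Set.indicator_of_notMem hx]
      simp only [Set.mem_univ_pi, not_forall] at hx
      obtain ⟨i, hi⟩ := hx
      exact (Finset.prod_eq_zero (Finset.mem_univ i) (Set.indicator_of_notMem hi _)).symm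
  rw [withDensity_apply _ (MeasurableSet.univ_pi hs),
    ← lintegral_indicator (MeasurableSet.univ_pi hs)]
  simp_rw [hind]
  rw [lintegral_fin_prod_eq_prod _ (fun i => (s i).indicator g) fun i => hg.indicator (hs i)]
  exact Finset.prod_congr rfl fun i _ => by
    rw [withDensity_apply _ (hs i), lintegral_indicator (hs i)]

/-! ### The law of the data and the two-point bound -/

section Law

variable {d N : ℕ}

/-- The density of one observation with respect to `Π ⊗ Lebesgue`. -/
noncomputable def obsDensity (σ : ℝ) (T : Tensor d N) (z : (Fin d → Fin N) × ℝ) : ℝ :=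
  gaussianPDFReal (T z.1) (Real.toNNReal (σ ^ 2)) z.2

theorem measurable_obsDensity (σ : ℝ) (T : Tensor d N) : Measurable (obsDensity σ T) := by
  have hT : Measurable fun z : (Fin d → Fin N) × ℝ => T z.1 :=
    (measurable_of_countable T).comp measurable_fst
  generalize hU : (fun z : (Fin d → Fin N) × ℝ => T z.1) = U at hT
  have h : obsDensity σ T = fun z => gaussianPDFReal (U z) (Real.toNNReal (σ ^ 2)) z.2 := by
    rw [← hU]
    rfl
  rw [h]
  unfold gaussianPDFReal
  fun_prop

theorem measurable_observe (σ : ℝ) (T : Tensor d N) :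
    Measurable fun z : (Fin d → Fin N) × ℝ => (z.1, T z.1 + σ * z.2) :=
  measurable_fst.prodMk
    (((measurable_of_countable T).comp measurable_fst).add (measurable_snd.const_mul σ))

theorem obsDensity_pos {σ : ℝ} (hσ : 0 < σ) (T : Tensor d N) (z : (Fin d → Fin N) × ℝ) :
    0 < obsDensity σ T z :=
  gaussianPDFReal_pos _ _ _ (by simp [hσ.ne'])

theorem observationLaw_eq_withDensity (P : PMF (Fin d → Fin N)) {σ : ℝ} (hσ : 0 < σ)
    (T : Tensor d N) :
    observationLaw P σ T
      = (P.toMeasure.prod volume).withDensity fun z => ENNReal.ofReal (obsDensity σ T z) := by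
  have hm := measurable_observe σ T
  have hd := (measurable_obsDensity σ T).ennreal_ofReal
  refine Measure.ext_of_lintegral _ fun F hF => ?_
  have hFm : Measurable fun z : (Fin d → Fin N) × ℝ => F (z.1, T z.1 + σ * z.2) := hF.comp hm
  rw [observationLaw, lintegral_map hF hm, lintegral_withDensity_eq_lintegral_mul _ hd hF,
    lintegral_prod _ hFm.aemeasurable, lintegral_prod _ (hd.mul hF).aemeasurable]
  refine lintegral_congr fun ω => ?_
  have hmap : (gaussianReal 0 1).map (fun ξ => T ω + σ * ξ)
      = gaussianReal (T ω) (Real.toNNReal (σ ^ 2)) := by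
    have h1 : (fun ξ => T ω + σ * ξ) = (fun y => T ω + y) ∘ (fun ξ => σ * ξ) := rfl
    rw [h1, ← Measure.map_map (by fun_prop) (by fun_prop), gaussianReal_map_const_mul,
      gaussianReal_map_const_add]
    congr 1
    · ring
    · ext
      simp [Real.coe_toNNReal _ (sq_nonneg σ)]
  have hF' : Measurable fun y : ℝ => F (ω, y) := hF.comp (by fun_prop)
  calc ∫⁻ ξ, F (ω, T ω + σ * ξ) ∂gaussianReal 0 1
      = ∫⁻ y, F (ω, y) ∂((gaussianReal 0 1).map (fun ξ => T ω + σ * ξ)) :=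
        (lintegral_map hF' (by fun_prop)).symm
    _ = ∫⁻ y, (fun z => ENNReal.ofReal (obsDensity σ T z) * F z) (ω, y) := by
        rw [hmap, gaussianReal_of_var_ne_zero _ (by simp [hσ.ne']),
          lintegral_withDensity_eq_lintegral_mul _ (measurable_gaussianPDF _ _) hF']
        rfl

instance (P : PMF (Fin d → Fin N)) (σ : ℝ) (T : Tensor d N) :
    IsProbabilityMeasure (observationLaw P σ T) := by
  exact Measure.isProbabilityMeasure_map (measurable_observe σ T).aemeasurable

theorem lintegral_dataLaw (m : ℕ) (P : PMF (Fin d → Fin N)) {σ : ℝ} (hσ : 0 < σ)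
    (T : Tensor d N) {F : (Fin m → (Fin d → Fin N) × ℝ) → ℝ≥0∞} (hF : Measurable F) :
    ∫⁻ z, F z ∂dataLaw m P σ T
      = ∫⁻ z, ENNReal.ofReal (∏ t, obsDensity σ T (z t)) * F z
          ∂Measure.pi fun _ => P.toMeasure.prod volume := by
  have hd := (measurable_obsDensity σ T).ennreal_ofReal
  have hE := observationLaw_eq_withDensity P hσ T
  have : IsProbabilityMeasure
      ((P.toMeasure.prod volume).withDensity fun z => ENNReal.ofReal (obsDensity σ T z)) :=
    hE ▸ inferInstance
  have hdm : Measurable fun z : Fin m → (Fin d → Fin N) × ℝ =>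
      ∏ t, ENNReal.ofReal (obsDensity σ T (z t)) :=
    Finset.measurable_fun_prod _ fun i _ => hd.comp (measurable_pi_apply i)
  rw [dataLaw, hE, pi_withDensity _ _ hd, lintegral_withDensity_eq_lintegral_mul _ hdm hF]
  refine lintegral_congr fun z => ?_
  rw [ENNReal.ofReal_prod_of_nonneg fun t _ => (obsDensity_pos hσ T _).le]
  rfl

theorem lintegral_dataLaw_prod (m : ℕ) (P : PMF (Fin d → Fin N)) (σ : ℝ) (T : Tensor d N)
    {c : (Fin d → Fin N) → ℝ} (hc : ∀ ω, 0 ≤ c ω) :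
    ∫⁻ z, ENNReal.ofReal (∏ t, c (z t).1) ∂dataLaw m P σ T
      = ENNReal.ofReal ((∑ ω, (P ω).toReal * c ω) ^ m) := by
  have hcm : Measurable c := measurable_of_countable c
  have hone : ∫⁻ z, ENNReal.ofReal (c z.1) ∂observationLaw P σ T
      = ENNReal.ofReal (∑ ω, (P ω).toReal * c ω) := by
    rw [observationLaw, lintegral_map (by fun_prop) (measurable_observe σ T),
      lintegral_prod _ (by fun_prop)]
    simp only [lintegral_const, measure_univ, mul_one]
    rw [lintegral_fintype, ENNReal.ofReal_sum_of_nonneg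
      fun ω _ => mul_nonneg ENNReal.toReal_nonneg (hc ω)]
    refine Finset.sum_congr rfl fun ω _ => ?_
    rw [P.toMeasure_apply_singleton _ (measurableSet_singleton _),
      ENNReal.ofReal_mul ENNReal.toReal_nonneg, ENNReal.ofReal_toReal (P.apply_ne_top ω), mul_comm]
  simp_rw [ENNReal.ofReal_prod_of_nonneg fun t (_ : t ∈ Finset.univ) => hc _]
  rw [dataLaw, lintegral_fin_prod_eq_prod _
    (fun _ (z : (Fin d → Fin N) × ℝ) => ENNReal.ofReal (c z.1))
    fun _ => by fun_prop]
  simp only [hone, Finset.prod_const, Finset.card_univ, Fintype.card_fin]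
  rw [ENNReal.ofReal_pow]
  exact Finset.sum_nonneg fun ω _ => mul_nonneg ENNReal.toReal_nonneg (hc ω)

theorem sum_toReal_eq_one (P : PMF (Fin d → Fin N)) : ∑ ω, (P ω).toReal = 1 := by
  rw [← ENNReal.toReal_sum fun ω _ => P.apply_ne_top ω, ← tsum_fintype (L := .unconditional _),
    P.tsum_coe, ENNReal.toReal_one]

/-- The computation of the Hellinger affinity behind the two-point bound: a Gaussian density
with mean `β` times one with mean `-β` is a constant times the square of the centred density. -/
theorem gaussianPDFReal_mul_neg (β σ y : ℝ) (hσ : 0 < σ) :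
    gaussianPDFReal β (Real.toNNReal (σ ^ 2)) y * gaussianPDFReal (-β) (Real.toNNReal (σ ^ 2)) y
      = Real.exp (-(β ^ 2 / σ ^ 2)) * gaussianPDFReal 0 (Real.toNNReal (σ ^ 2)) y ^ 2 := by
  simp only [gaussianPDFReal, Real.coe_toNNReal _ (sq_nonneg σ)]
  have : Real.exp (-(y - β) ^ 2 / (2 * σ ^ 2)) * Real.exp (-(y - -β) ^ 2 / (2 * σ ^ 2))
      = Real.exp (-(β ^ 2 / σ ^ 2)) * Real.exp (-(y - 0) ^ 2 / (2 * σ ^ 2)) ^ 2 := by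
    rw [← Real.exp_add, ← Real.exp_nat_mul, ← Real.exp_add]
    congr 1
    field_simp
    ring
  calc _ = (√(2 * Real.pi * σ ^ 2))⁻¹ ^ 2 * (Real.exp (-(y - β) ^ 2 / (2 * σ ^ 2))
        * Real.exp (-(y - -β) ^ 2 / (2 * σ ^ 2))) := by ring
    _ = _ := by rw [this]; ring

/-- The integrand of the two-point bound. Minimizing over `e` leaves `4 β² p q / (p + q)`, and then
the inequality of the arithmetic and geometric means applies. -/
theorem two_point_pointwise {p q r C e β : ℝ} (hp : 0 < p) (hq : 0 < q) (hC : 0 ≤ C)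
    (h : p * q = C * r ^ 2) :
    4 * β ^ 2 * (r * C)
      ≤ p * (e - β) ^ 2 + q * (e + β) ^ 2 + β ^ 2 * (p * C) + β ^ 2 * (q * C) := by
  have hpq : 0 < p + q := by positivity
  refine le_of_mul_le_mul_left ?_ hpq
  have h1 : 0 ≤ ((p + q) * e - (p - q) * β) ^ 2 := sq_nonneg _
  have h2 : 0 ≤ β ^ 2 * C * (2 * r - (p + q)) ^ 2 := by positivity
  have h3 : β ^ 2 * (p * q) = β ^ 2 * (C * r ^ 2) := by rw [h]
  nlinarith

/-- Two tensors that agree off `S` and equal `β` and `-β` on `S` are hard to tell apart: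
with the Gaussian likelihoods `p`, `q`, the least sum of the two risks at an entry of `S` is
`4 β² ∫ p q / (p + q)`, and conditioning on the sampled positions bounds it below. -/
theorem two_point_risk (m : ℕ) (P : PMF (Fin d → Fin N)) {σ : ℝ} (hσ : 0 < σ) (β : ℝ)
    (S : Finset (Fin d → Fin N)) {T T' : Tensor d N} (hT : ∀ ω ∈ S, T ω = β)
    (hT' : ∀ ω ∈ S, T' ω = -β) (hTT' : ∀ ω, ω ∉ S → T ω = T' ω)
    {e : (Fin m → (Fin d → Fin N) × ℝ) → ℝ} (he : Measurable e) :
    ENNReal.ofReal (2 * β ^ 2 *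
        (1 - (∑ ω ∈ S, (P ω).toReal) * (1 - Real.exp (-(β ^ 2 / σ ^ 2)))) ^ m)
      ≤ ∫⁻ z, ENNReal.ofReal ((e z - β) ^ 2) ∂dataLaw m P σ T
        + ∫⁻ z, ENNReal.ofReal ((e z + β) ^ 2) ∂dataLaw m P σ T' := by
  classical
  set a : ℝ := Real.exp (-(β ^ 2 / σ ^ 2)) with ha
  have ha0 : 0 < a := Real.exp_pos _
  -- the squared affinity of the two laws of one observation, given its position
  let c : (Fin d → Fin N) → ℝ := fun ω => if ω ∈ S then a else 1
  -- the midpoint of `T` and `T'`, whose likelihood is proportional to `√(p q)`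
  let M : Tensor d N := fun ω => if ω ∈ S then 0 else T ω
  have hc : ∀ ω, 0 ≤ c ω := fun ω => by dsimp only [c]; split_ifs <;> positivity
  have hcm : Measurable c := measurable_of_countable c
  have hsum : ∑ ω, (P ω).toReal * c ω = 1 - (∑ ω ∈ S, (P ω).toReal) * (1 - a) := by
    have h2 : ∀ ω, (P ω).toReal * c ω
        = (P ω).toReal - (if ω ∈ S then (P ω).toReal else 0) * (1 - a) := by
      intro ω
      dsimp only [c]
      split_ifs <;> ring
    rw [Finset.sum_congr rfl fun ω _ => h2 ω, Finset.sum_sub_distrib, sum_toReal_eq_one,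
      ← Finset.sum_mul, Finset.sum_ite_mem, Finset.univ_inter]
  set Q : ℝ := 1 - (∑ ω ∈ S, (P ω).toReal) * (1 - a) with hQ
  have hQ0 : 0 ≤ Q := hsum ▸ Finset.sum_nonneg fun ω _ => mul_nonneg ENNReal.toReal_nonneg (hc ω)
  have hC : ∀ U : Tensor d N, ∫⁻ z, ENNReal.ofReal (∏ t, c (z t).1) ∂dataLaw m P σ U
      = ENNReal.ofReal (Q ^ m) := fun U => by rw [lintegral_dataLaw_prod m P σ U hc, hsum]
  have hβ : 0 ≤ β ^ 2 := sq_nonneg β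
  have hdm : ∀ U : Tensor d N, Measurable fun z : Fin m → (Fin d → Fin N) × ℝ =>
      ENNReal.ofReal (∏ t, obsDensity σ U (z t)) := fun U =>
    (Finset.measurable_fun_prod _ fun i _ =>
      (measurable_obsDensity σ U).comp (measurable_pi_apply i)).ennreal_ofReal
  have hCm : Measurable fun z : Fin m → (Fin d → Fin N) × ℝ =>
      ENNReal.ofReal (∏ t, c (z t).1) :=
    (Finset.measurable_fun_prod _ fun i _ =>
      hcm.comp (measurable_fst.comp (measurable_pi_apply i))).ennreal_ofReal
  have hdC : ∀ U : Tensor d N, Measurable fun z : Fin m → (Fin d → Fin N) × ℝ =>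
      ENNReal.ofReal (∏ t, obsDensity σ U (z t)) * ENNReal.ofReal (∏ t, c (z t).1) :=
    fun U => (hdm U).mul hCm
  have hdT := hdm T
  have hdT' := hdm T'
  have hpos : ∀ (U : Tensor d N) (z : Fin m → (Fin d → Fin N) × ℝ),
      0 < ∏ t, obsDensity σ U (z t) := fun U z =>
    Finset.prod_pos fun t _ => obsDensity_pos hσ U _
  have hprod : ∀ z : Fin m → (Fin d → Fin N) × ℝ,
      (∏ t, obsDensity σ T (z t)) * ∏ t, obsDensity σ T' (z t)
        = (∏ t, c (z t).1) * (∏ t, obsDensity σ M (z t)) ^ 2 := by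
    intro z
    rw [← Finset.prod_mul_distrib, ← Finset.prod_pow, ← Finset.prod_mul_distrib]
    refine Finset.prod_congr rfl fun t _ => ?_
    dsimp only [obsDensity, c, M]
    split_ifs with h
    · rw [hT _ h, hT' _ h, gaussianPDFReal_mul_neg _ _ _ hσ]
    · rw [hTT' _ h]; ring
  have key : ENNReal.ofReal (4 * β ^ 2) * ENNReal.ofReal (Q ^ m)
      ≤ (∫⁻ z, ENNReal.ofReal ((e z - β) ^ 2) ∂dataLaw m P σ T
        + ∫⁻ z, ENNReal.ofReal ((e z + β) ^ 2) ∂dataLaw m P σ T')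
        + (ENNReal.ofReal (β ^ 2) * ENNReal.ofReal (Q ^ m)
          + ENNReal.ofReal (β ^ 2) * ENNReal.ofReal (Q ^ m)) := by
    have e1 := hC M
    have e2 := hC T
    have e3 := hC T'
    rw [lintegral_dataLaw m P hσ _ hCm] at e1 e2 e3
    nth_rewrite 1 [← e1]
    nth_rewrite 1 [← e2]
    rw [← e3, lintegral_dataLaw m P hσ T (by fun_prop), lintegral_dataLaw m P hσ T' (by fun_prop),
      ← lintegral_const_mul _ (hdC M), ← lintegral_const_mul _ (hdC T),
      ← lintegral_const_mul _ (hdC T'), ← lintegral_add_left (by fun_prop),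
      ← lintegral_add_left ((hdC T).const_mul _), ← lintegral_add_left (by fun_prop)]
    refine lintegral_mono fun z => ?_
    have hCz : 0 ≤ ∏ t, c (z t).1 := Finset.prod_nonneg fun t _ => hc _
    have hT0 := (hpos T z).le
    have hT'0 := (hpos T' z).le
    have hM0 := (hpos M z).le
    rw [← ENNReal.ofReal_mul hM0, ← ENNReal.ofReal_mul hT0, ← ENNReal.ofReal_mul hT'0,
      ← ENNReal.ofReal_mul hT0, ← ENNReal.ofReal_mul hT'0, ← ENNReal.ofReal_mul (by positivity),
      ← ENNReal.ofReal_mul hβ, ← ENNReal.ofReal_mul hβ, ← ENNReal.ofReal_add (by positivity)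
      (by positivity), ← ENNReal.ofReal_add (by positivity) (by positivity),
      ← ENNReal.ofReal_add (by positivity) (by positivity)]
    refine ENNReal.ofReal_le_ofReal ?_
    have := two_point_pointwise (e := e z) (β := β) (hpos T z) (hpos T' z) hCz (hprod z)
    linarith
  rw [← ENNReal.ofReal_mul (by positivity), ← ENNReal.ofReal_mul hβ,
    ← ENNReal.ofReal_add (by positivity) (by positivity)] at key
  have hsplit : ENNReal.ofReal (4 * β ^ 2 * Q ^ m)
      = ENNReal.ofReal (2 * β ^ 2 * Q ^ m)
        + ENNReal.ofReal (β ^ 2 * Q ^ m + β ^ 2 * Q ^ m) := by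
    rw [← ENNReal.ofReal_add (by positivity) (by positivity)]
    congr 1
    ring
  rw [hsplit] at key
  exact (ENNReal.add_le_add_iff_right ENNReal.ofReal_ne_top).1 key

end Law

/-! ### Signs -/

/-- The sign `±1` encoded by a Boolean. -/
def sg (b : Bool) : ℝ := if b then 1 else -1

theorem sg_not (b : Bool) : sg (!b) = -sg b := by cases b <;> simp [sg]

theorem sg_mul_self (b : Bool) : sg b * sg b = 1 := by cases b <;> simp [sg]

theorem sg_sq (b : Bool) : sg b ^ 2 = 1 := by rw [sq, sg_mul_self]

theorem abs_sg (b : Bool) : |sg b| = 1 := by cases b <;> simp [sg]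

/-- The sign vector `θ` with its sign at `z` reversed. -/
def flipSign {J : Type*} [DecidableEq J] (z : J) (θ : J → Bool) : J → Bool :=
  Function.update θ z (!θ z)

section Flip

variable {J : Type*} [DecidableEq J]

theorem flipSign_same (z : J) (θ : J → Bool) : flipSign z θ z = !θ z := by simp [flipSign]

theorem flipSign_of_ne {z p : J} (h : p ≠ z) (θ : J → Bool) : flipSign z θ p = θ p := by
  simp [flipSign, h]

theorem flipSign_involutive (z : J) : Function.Involutive (flipSign z) := by
  intro θ
  ext p
  by_cases h : p = z
  · subst h; simp [flipSign]
  · simp [flipSign, h]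

theorem sum_comp_flipSign {M : Type*} [AddCommMonoid M] [Fintype J] (z : J) (F : (J → Bool) → M) :
    ∑ θ, F (flipSign z θ) = ∑ θ, F θ :=
  Equiv.sum_comp (flipSign_involutive z).toPerm F

end Flip

/-! ### Assouad's argument for block tensors -/

section Assouad

variable {d N : ℕ}

/-- The tensor with entries `±β` that is constant on the fibres of `f`, with sign `θ z` on the
fibre of `z`. -/
def blockTensor {J : Type*} (β : ℝ) (f : (Fin d → Fin N) → J) (θ : J → Bool) : Tensor d N :=
  fun ω => β * sg (θ (f ω))

/-- The contribution of the entry `ω` to the normalized risk. -/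
noncomputable def entryRisk {m : ℕ} (P : PMF (Fin d → Fin N)) (σ : ℝ)
    (est : (Fin m → (Fin d → Fin N) × ℝ) → Tensor d N) (T : Tensor d N) (ω : Fin d → Fin N) :
    ℝ≥0∞ :=
  ENNReal.ofReal ((N : ℝ) ^ d)⁻¹ * ∫⁻ z, ENNReal.ofReal ((est z ω - T ω) ^ 2) ∂dataLaw m P σ T

theorem risk_eq_sum_entryRisk {m : ℕ} (P : PMF (Fin d → Fin N)) (σ : ℝ)
    {est : (Fin m → (Fin d → Fin N) × ℝ) → Tensor d N} (hest : Measurable est) (T : Tensor d N) :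
    risk P σ est T = ∑ ω, entryRisk P σ est T ω := by
  have hm : ∀ ω, Measurable fun z => ENNReal.ofReal ((est z ω - T ω) ^ 2) := fun ω =>
    ((((measurable_pi_apply ω).comp hest).sub_const (T ω)).pow_const 2).ennreal_ofReal
  simp only [risk, entryRisk]
  rw [← Finset.mul_sum, ← lintegral_finsetSum _ fun ω _ => hm ω,
    ← lintegral_const_mul _ (Finset.measurable_fun_sum _ fun ω _ => hm ω)]
  refine lintegral_congr fun z => ?_
  rw [← ENNReal.ofReal_sum_of_nonneg fun ω _ => sq_nonneg _, ← ENNReal.ofReal_mul (by positivity)]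
  congr 1
  simp only [frobeniusSq, Pi.sub_apply]
  ring

/-- The probability that a sampled position lies in the fibre of `f` through `ω`. -/
noncomputable def fibreMass {J : Type*} [DecidableEq J] (P : PMF (Fin d → Fin N))
    (f : (Fin d → Fin N) → J) (ω : Fin d → Fin N) : ℝ :=
  ∑ ω' with f ω' = f ω, (P ω').toReal

theorem entryRisk_add_flip {J : Type*} [DecidableEq J] (m : ℕ) (P : PMF (Fin d → Fin N)) {σ : ℝ}
    (hσ : 0 < σ) (β : ℝ) (f : (Fin d → Fin N) → J)
    {est : (Fin m → (Fin d → Fin N) × ℝ) → Tensor d N} (hest : Measurable est)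
    (ω : Fin d → Fin N) (θ : J → Bool) :
    ENNReal.ofReal (((N : ℝ) ^ d)⁻¹ * (2 * β ^ 2 *
        (1 - fibreMass P f ω * (1 - Real.exp (-(β ^ 2 / σ ^ 2)))) ^ m))
      ≤ entryRisk P σ est (blockTensor β f θ) ω
        + entryRisk P σ est (blockTensor β f (flipSign (f ω) θ)) ω := by
  rw [ENNReal.ofReal_mul (by positivity), entryRisk, entryRisk, ← mul_add]
  gcongr
  have he : Measurable fun z => est z ω := (measurable_pi_apply ω).comp hest
  -- `two_point_risk` at an arbitrary assignment with the sign `true` at `f ω`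
  have key : ∀ η : J → Bool, η (f ω) = true → _ := fun η hη =>
    two_point_risk m P hσ β (Finset.univ.filter fun ω' => f ω' = f ω)
      (T := blockTensor β f η) (T' := blockTensor β f (flipSign (f ω) η))
      (fun ω' h => by
        rw [Finset.mem_filter] at h
        simp [blockTensor, h.2, hη, sg])
      (fun ω' h => by
        rw [Finset.mem_filter] at h
        simp [blockTensor, h.2, hη, sg, flipSign_same])
      (fun ω' h => by
        have h' : f ω' ≠ f ω := by simpa using h
        simp [blockTensor, flipSign_of_ne h'])
      he
  cases hθ : θ (f ω) with
  | true =>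
    have h := key θ hθ
    simpa [blockTensor, hθ, sg, flipSign_same, fibreMass] using h
  | false =>
    have h := key (flipSign (f ω) θ) (by simp [flipSign_same, hθ])
    rw [flipSign_involutive (f ω) θ, add_comm] at h
    simpa [blockTensor, hθ, sg, flipSign_same, fibreMass] using h

/-- Assouad's argument over a set `G` containing at least three quarters of all sign vectors: at
each entry, at least half of all sign vectors lie in `G` together with their neighbour. -/
theorem assouad_bound {J : Type*} [Fintype J] [DecidableEq J] {m : ℕ} (P : PMF (Fin d → Fin N))
    {σ : ℝ} (hσ : 0 < σ) (β : ℝ) (f : (Fin d → Fin N) → J) (G : Finset (J → Bool))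
    (hG : 4 * Gᶜ.card ≤ Fintype.card (J → Bool))
    {est : (Fin m → (Fin d → Fin N) × ℝ) → Tensor d N} (hest : Measurable est)
    {ρ : ℝ≥0∞} (hρ : ∀ θ ∈ G, risk P σ est (blockTensor β f θ) ≤ ρ)
    (hq : ∀ ω, 0 ≤ 1 - fibreMass P f ω * (1 - Real.exp (-(β ^ 2 / σ ^ 2)))) :
    ENNReal.ofReal (β ^ 2 / 2 * (((N : ℝ) ^ d)⁻¹ *
        ∑ ω, (1 - fibreMass P f ω * (1 - Real.exp (-(β ^ 2 / σ ^ 2)))) ^ m)) ≤ ρ := by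
  set q : (Fin d → Fin N) → ℝ := fun ω =>
    1 - fibreMass P f ω * (1 - Real.exp (-(β ^ 2 / σ ^ 2))) with hqdef
  set R : (Fin d → Fin N) → (J → Bool) → ℝ≥0∞ := fun ω θ =>
    entryRisk P σ est (blockTensor β f θ) ω with hR
  set n : ℕ := Fintype.card (J → Bool) with hn
  have hn0 : (n : ℝ≥0∞) ≠ 0 := by simp [hn]
  have hentry : ∀ ω, (n : ℝ≥0∞) * ENNReal.ofReal (((N : ℝ) ^ d)⁻¹ * (2 * β ^ 2 * q ω ^ m))
      ≤ 4 * ∑ θ ∈ G, R ω θ := by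
    intro ω
    set H : Finset (J → Bool) := G.filter fun θ => flipSign (f ω) θ ∈ G with hH
    have hcard : n ≤ 2 * H.card := by
      have h1 : Hᶜ ⊆ Gᶜ ∪ Gᶜ.map (flipSign_involutive (f ω)).toPerm.toEmbedding := by
        intro θ hθ
        rw [Finset.mem_compl, hH, Finset.mem_filter, not_and_or] at hθ
        rw [Finset.mem_union, Finset.mem_compl]
        refine hθ.imp id fun h => Finset.mem_map.2 ⟨flipSign (f ω) θ, by simpa using h, ?_⟩
        exact flipSign_involutive (f ω) θ
      have h2 := (Finset.card_le_card h1).trans (Finset.card_union_le _ _)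
      rw [Finset.card_map] at h2
      have h3 := Finset.card_add_card_compl H
      omega
    have hflip : ∑ θ ∈ H, R ω (flipSign (f ω) θ) = ∑ θ ∈ H, R ω θ := by
      refine Finset.sum_nbij' (flipSign (f ω)) (flipSign (f ω)) ?_ ?_ ?_ ?_ ?_
      · intro θ hθ
        rw [hH, Finset.mem_filter] at hθ ⊢
        exact ⟨hθ.2, by rw [flipSign_involutive]; exact hθ.1⟩
      · intro θ hθ
        rw [hH, Finset.mem_filter] at hθ ⊢
        exact ⟨hθ.2, by rw [flipSign_involutive]; exact hθ.1⟩
      · exact fun θ _ => flipSign_involutive _ θ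
      · exact fun θ _ => flipSign_involutive _ θ
      · exact fun θ _ => rfl
    calc (n : ℝ≥0∞) * ENNReal.ofReal (((N : ℝ) ^ d)⁻¹ * (2 * β ^ 2 * q ω ^ m))
        ≤ (2 * H.card : ℕ) * ENNReal.ofReal (((N : ℝ) ^ d)⁻¹ * (2 * β ^ 2 * q ω ^ m)) := by
          gcongr
      _ = 2 * ∑ _θ ∈ H, ENNReal.ofReal (((N : ℝ) ^ d)⁻¹ * (2 * β ^ 2 * q ω ^ m)) := by
          rw [Finset.sum_const, nsmul_eq_mul]
          push_cast
          ring
      _ ≤ 2 * ∑ θ ∈ H, (R ω θ + R ω (flipSign (f ω) θ)) := by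
          gcongr with θ hθ
          exact entryRisk_add_flip m P hσ β f hest ω θ
      _ = 4 * ∑ θ ∈ H, R ω θ := by
          rw [Finset.sum_add_distrib, hflip]
          ring
      _ ≤ 4 * ∑ θ ∈ G, R ω θ := by
          gcongr
          exact Finset.filter_subset _ _
  have htotal : ∑ ω, ∑ θ ∈ G, R ω θ ≤ n * ρ := by
    rw [Finset.sum_comm]
    calc ∑ θ ∈ G, ∑ ω, R ω θ ≤ ∑ _θ ∈ G, ρ :=
          Finset.sum_le_sum fun θ hθ => by
            rw [hR, ← risk_eq_sum_entryRisk P σ hest]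
            exact hρ θ hθ
      _ ≤ n * ρ := by
          rw [Finset.sum_const, nsmul_eq_mul]
          gcongr
          exact Finset.card_le_univ G
  have hsum : (n : ℝ≥0∞) * (4 * ENNReal.ofReal (β ^ 2 / 2 * (((N : ℝ) ^ d)⁻¹ * ∑ ω, q ω ^ m)))
      ≤ n * (4 * ρ) := by
    have h4 : (4 : ℝ≥0∞) = ENNReal.ofReal 4 := by norm_num
    have hreal : 4 * (β ^ 2 / 2 * (((N : ℝ) ^ d)⁻¹ * ∑ ω, q ω ^ m))
        = ∑ ω, ((N : ℝ) ^ d)⁻¹ * (2 * β ^ 2 * q ω ^ m) := by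
      rw [← Finset.mul_sum, ← Finset.mul_sum]
      ring
    calc (n : ℝ≥0∞) * (4 * ENNReal.ofReal (β ^ 2 / 2 * (((N : ℝ) ^ d)⁻¹ * ∑ ω, q ω ^ m)))
        = ∑ ω, (n : ℝ≥0∞) * ENNReal.ofReal (((N : ℝ) ^ d)⁻¹ * (2 * β ^ 2 * q ω ^ m)) := by
          rw [h4, ← ENNReal.ofReal_mul (by norm_num), hreal, ENNReal.ofReal_sum_of_nonneg,
            Finset.mul_sum]
          intro ω _
          have := pow_nonneg (hq ω) m
          positivity
      _ ≤ ∑ ω, 4 * ∑ θ ∈ G, R ω θ := Finset.sum_le_sum fun ω _ => hentry ω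
      _ = 4 * ∑ ω, ∑ θ ∈ G, R ω θ := by rw [Finset.mul_sum]
      _ ≤ 4 * (n * ρ) := by gcongr
      _ = n * (4 * ρ) := by ring
  have h := (ENNReal.mul_le_mul_iff_right hn0 (ENNReal.natCast_ne_top n)).1 hsum
  exact (ENNReal.mul_le_mul_iff_right (by norm_num) (by norm_num)).1 h

theorem quarter_le_one_sub_inv_pow {n m : ℕ} (hn : 2 ≤ n) (hm : m ≤ n) :
    (1 / 4 : ℝ) ≤ (1 - 1 / (n : ℝ)) ^ m := by
  have hn2 : (2 : ℝ) ≤ n := by exact_mod_cast hn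
  have hn0 : (0 : ℝ) < n := by linarith
  have h0 : 0 ≤ 1 - 1 / (n : ℝ) := by
    rw [sub_nonneg, div_le_one hn0]
    linarith
  have h1 : 1 - 1 / (n : ℝ) ≤ 1 := by
    have : 0 ≤ 1 / (n : ℝ) := by positivity
    linarith
  have h2 := one_add_mul_self_le_rpow_one_add (s := -(1 / (n : ℝ))) (by linarith)
    (p := (n : ℝ) / 2) (by linarith)
  have h3 : 1 + (n : ℝ) / 2 * -(1 / (n : ℝ)) = 1 / 2 := by
    field_simp
    norm_num
  rw [h3, ← sub_eq_add_neg] at h2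
  calc (1 / 4 : ℝ) = (1 / 2) ^ 2 := by norm_num
    _ ≤ ((1 - 1 / (n : ℝ)) ^ ((n : ℝ) / 2)) ^ 2 := by gcongr
    _ = (1 - 1 / (n : ℝ)) ^ n := by
        rw [← Real.rpow_natCast, ← Real.rpow_mul h0, ← Real.rpow_natCast]
        congr 1
        push_cast
        ring
    _ ≤ (1 - 1 / (n : ℝ)) ^ m := pow_le_pow_of_le_one h0 h1 hm

/-- The lower bound `β² / 8` for a family of block tensors: it holds when the blocks are so small
that the noise hides them, and, whatever the noise, when the blocks are single entries, since
`m ≤ Nᵈ` observations leave a constant fraction of the entries unseen. -/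
theorem le_minimaxRisk_of_blocks {J : Type*} [Fintype J] [DecidableEq J] {m : ℕ}
    (P : PMF (Fin d → Fin N)) {σ : ℝ} (hσ : 0 < σ) (hN : 2 ≤ N) (hd : 1 ≤ d) (hmN : m ≤ N ^ d)
    (β : ℝ) (f : (Fin d → Fin N) → J) (G : Finset (J → Bool))
    (hG : 4 * Gᶜ.card ≤ Fintype.card (J → Bool)) {S : Set (Tensor d N)}
    (hS : ∀ θ ∈ G, blockTensor β f θ ∈ S) {w : ℝ} (hw1 : w ≤ 1)
    (hw : ∀ ω, ((Finset.univ.filter fun ω' => f ω' = f ω).card : ℝ) ≤ w * (N : ℝ) ^ d)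
    (h : (m : ℝ) * w * β ^ 2 ≤ σ ^ 2 / 2 ∨ w = 1 / (N : ℝ) ^ d) :
    ENNReal.ofReal (β ^ 2 / 8) ≤ minimaxRisk m P σ S := by
  have hN0 : (0 : ℝ) < N := by exact_mod_cast (by omega : 0 < N)
  have hNd : (0 : ℝ) < (N : ℝ) ^ d := by positivity
  set η : ℝ := 1 - Real.exp (-(β ^ 2 / σ ^ 2)) with hη
  have hη0 : 0 ≤ η := by
    have : Real.exp (-(β ^ 2 / σ ^ 2)) ≤ 1 := Real.exp_le_one_iff.2 (by
      have : 0 ≤ β ^ 2 / σ ^ 2 := by positivity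
      linarith)
    linarith
  have hη1 : η ≤ 1 := by
    have := Real.exp_pos (-(β ^ 2 / σ ^ 2))
    linarith
  have hηs : η ≤ β ^ 2 / σ ^ 2 := by
    have := Real.add_one_le_exp (-(β ^ 2 / σ ^ 2))
    linarith
  have hπ0 : ∀ ω, 0 ≤ fibreMass P f ω := fun ω =>
    Finset.sum_nonneg fun _ _ => ENNReal.toReal_nonneg
  have hπ1 : ∀ ω, fibreMass P f ω ≤ 1 := fun ω => by
    rw [← sum_toReal_eq_one P]
    exact Finset.sum_le_univ_sum_of_nonneg fun _ => ENNReal.toReal_nonneg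
  have hq : ∀ ω, 0 ≤ 1 - fibreMass P f ω * η := fun ω => by
    have : fibreMass P f ω * η ≤ 1 * 1 := mul_le_mul (hπ1 ω) hη1 hη0 zero_le_one
    linarith
  have hcardω : Fintype.card (Fin d → Fin N) = N ^ d := by simp
  -- the mean mass of the block through a uniformly chosen entry is at most `w`
  have hmean : ((N : ℝ) ^ d)⁻¹ * ∑ ω, fibreMass P f ω ≤ w := by
    rw [inv_mul_le_iff₀ hNd]
    calc ∑ ω, fibreMass P f ω
        = ∑ ω', (P ω').toReal * ((Finset.univ.filter fun ω => f ω = f ω').card : ℝ) := by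
          simp only [fibreMass, Finset.sum_filter]
          rw [Finset.sum_comm]
          refine Finset.sum_congr rfl fun ω' _ => ?_
          rw [← Finset.sum_filter, Finset.sum_const, nsmul_eq_mul, mul_comm]
          simp only [eq_comm]
      _ ≤ ∑ ω', (P ω').toReal * (w * (N : ℝ) ^ d) := by
          gcongr with ω' _
          exact hw ω'
      _ = (N : ℝ) ^ d * w := by rw [← Finset.sum_mul, sum_toReal_eq_one]; ring
  have hjensen : (1 - w * η) ^ m ≤ ((N : ℝ) ^ d)⁻¹ * ∑ ω, (1 - fibreMass P f ω * η) ^ m := by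
    have hone : ∑ _ω : Fin d → Fin N, ((N : ℝ) ^ d)⁻¹ = 1 := by
      rw [Finset.sum_const, Finset.card_univ, hcardω, nsmul_eq_mul]
      push_cast
      exact mul_inv_cancel₀ hNd.ne'
    have hJ := Real.pow_arith_mean_le_arith_mean_pow Finset.univ
      (fun _ : Fin d → Fin N => ((N : ℝ) ^ d)⁻¹) (fun ω => 1 - fibreMass P f ω * η)
      (fun _ _ => by positivity) hone (fun ω _ => hq ω) m
    rw [← Finset.mul_sum, ← Finset.mul_sum] at hJ
    refine le_trans (pow_le_pow_left₀ ?_ ?_ m) hJ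
    · have : w * η ≤ 1 * 1 := mul_le_mul hw1 hη1 hη0 zero_le_one
      linarith
    · rw [Finset.mul_sum]
      have : ∑ ω : Fin d → Fin N, ((N : ℝ) ^ d)⁻¹ * (1 - fibreMass P f ω * η)
          = 1 - (((N : ℝ) ^ d)⁻¹ * ∑ ω, fibreMass P f ω) * η := by
        simp only [mul_sub, Finset.sum_sub_distrib, mul_one]
        rw [hone, Finset.mul_sum, Finset.sum_mul]
        simp only [mul_assoc]
      rw [this]
      have := mul_le_mul_of_nonneg_right hmean hη0
      linarith
  have hw0 : 0 ≤ w := by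
    refine le_trans ?_ hmean
    exact mul_nonneg (by positivity) (Finset.sum_nonneg fun ω _ => hπ0 ω)
  have hwη : w * η ≤ 1 := by
    have : w * η ≤ 1 * 1 := mul_le_mul hw1 hη1 hη0 zero_le_one
    linarith
  have hquarter : (1 / 4 : ℝ) ≤ (1 - w * η) ^ m := by
    rcases h with h | h
    · have hB := one_add_mul_le_pow (a := -(w * η)) (by linarith) m
      rw [← sub_eq_add_neg] at hB
      refine le_trans ?_ hB
      have h1 : (m : ℝ) * (w * η) ≤ m * (w * (β ^ 2 / σ ^ 2)) := by gcongr
      have h2 : (m : ℝ) * (w * (β ^ 2 / σ ^ 2)) ≤ 1 / 2 := by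
        rw [← mul_div_assoc, ← mul_div_assoc, div_le_iff₀ (by positivity)]
        linarith
      linarith
    · refine le_trans (quarter_le_one_sub_inv_pow (n := N ^ d) ?_ hmN) ?_
      · calc 2 ≤ N := hN
          _ = N ^ 1 := (pow_one N).symm
          _ ≤ N ^ d := Nat.pow_le_pow_right (by omega) hd
      · push_cast
        rw [← h]
        have h3 : w * η ≤ w * 1 := by gcongr
        exact pow_le_pow_left₀ (by linarith) (by linarith) m
  refine le_iInf₂ fun est hest => ?_
  refine le_trans (ENNReal.ofReal_le_ofReal ?_) (assouad_bound P hσ β f G hG hest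
    (ρ := ⨆ T ∈ S, risk P σ est T) (fun θ hθ => le_iSup₂ (f := fun T _ => risk P σ est T)
      (blockTensor β f θ) (hS θ hθ)) hq)
  calc β ^ 2 / 8 = β ^ 2 / 2 * (1 / 4) := by ring
    _ ≤ _ := by
      gcongr
      exact hquarter.trans hjensen

end Assouad

/-! ### Moments of Rademacher forms -/

section Rademacher

variable {J : Type*} [DecidableEq J]

theorem sg_flipSign_same (z : J) (θ : J → Bool) : sg (flipSign z θ z) = -sg (θ z) := by
  rw [flipSign_same, sg_not]

variable [Fintype J]

theorem sum_eq_zero_of_flipSign {F : (J → Bool) → ℝ} (z : J)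
    (h : ∀ θ, F (flipSign z θ) = -F θ) : ∑ θ, F θ = 0 := by
  have h1 := sum_comp_flipSign z F
  simp only [h, Finset.sum_neg_distrib] at h1
  linarith

theorem sum_sg_mul_sg {p q : J} :
    ∑ θ : J → Bool, sg (θ p) * sg (θ q) = if p = q then (Fintype.card (J → Bool) : ℝ) else 0 := by
  split_ifs with h
  · subst h
    simp [sg_mul_self]
  · refine sum_eq_zero_of_flipSign p fun θ => ?_
    rw [sg_flipSign_same, flipSign_of_ne (Ne.symm h)]
    ring

theorem sum_sg_four {p q r s : J} (hpq : p ≠ q) :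
    ∑ θ : J → Bool, sg (θ p) * sg (θ q) * (sg (θ r) * sg (θ s))
      = (Fintype.card (J → Bool) : ℝ) *
        ((if r = p ∧ s = q then 1 else 0) + if r = q ∧ s = p then 1 else 0) := by
  by_cases h1 : r = p ∧ s = q
  · obtain ⟨rfl, rfl⟩ := h1
    have h : ∀ θ : J → Bool, sg (θ r) * sg (θ s) * (sg (θ r) * sg (θ s)) = 1 := fun θ => by
      rw [mul_mul_mul_comm, sg_mul_self, sg_mul_self, one_mul]
    have h2 : ¬(r = s ∧ s = r) := fun h => hpq h.1
    simp [h, h2]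
  by_cases h2 : r = q ∧ s = p
  · obtain ⟨rfl, rfl⟩ := h2
    have h : ∀ θ : J → Bool, sg (θ s) * sg (θ r) * (sg (θ r) * sg (θ s)) = 1 := fun θ => by
      rw [mul_comm (sg (θ s)), mul_mul_mul_comm, sg_mul_self, sg_mul_self, one_mul]
    simp [h, h1]
  simp only [h1, h2, if_false, add_zero, mul_zero]
  -- some index occurs exactly once among `p, q, r, s`; reversing its sign negates the product
  by_cases hp : p = r ∨ p = s
  · have hq : q ≠ r ∧ q ≠ s := by
      rcases hp with hp | hp
      · exact ⟨fun h => hpq (hp.trans h.symm), fun h => h1 ⟨hp.symm, h.symm⟩⟩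
      · exact ⟨fun h => h2 ⟨h.symm, hp.symm⟩, fun h => hpq (hp.trans h.symm)⟩
    refine sum_eq_zero_of_flipSign q fun θ => ?_
    rw [sg_flipSign_same, flipSign_of_ne hpq, flipSign_of_ne hq.1.symm, flipSign_of_ne hq.2.symm]
    ring
  · rw [not_or] at hp
    refine sum_eq_zero_of_flipSign p fun θ => ?_
    rw [sg_flipSign_same, flipSign_of_ne hpq.symm, flipSign_of_ne (Ne.symm hp.1),
      flipSign_of_ne (Ne.symm hp.2)]
    ring

/-- The second moment of a Rademacher quadratic form without diagonal terms. -/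
theorem sum_quadratic_sq (M : J → J → ℝ) (hM : ∀ p, M p p = 0) :
    ∑ θ : J → Bool, (∑ p, ∑ q, M p q * (sg (θ p) * sg (θ q))) ^ 2
      = (Fintype.card (J → Bool) : ℝ) * ∑ p, ∑ q, M p q * (M p q + M q p) := by
  have hinner : ∀ p q, ∑ r, ∑ s, ∑ θ : J → Bool,
      M p q * (sg (θ p) * sg (θ q)) * (M r s * (sg (θ r) * sg (θ s)))
      = (Fintype.card (J → Bool) : ℝ) * (M p q * (M p q + M q p)) := by
    intro p q
    by_cases hpq : p = q
    · subst hpq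
      simp [hM]
    have h : ∀ r s, ∑ θ : J → Bool,
        M p q * (sg (θ p) * sg (θ q)) * (M r s * (sg (θ r) * sg (θ s)))
        = (Fintype.card (J → Bool) : ℝ) * M p q * (M r s *
          ((if r = p ∧ s = q then 1 else 0) + if r = q ∧ s = p then 1 else 0)) := by
      intro r s
      rw [mul_assoc, mul_left_comm _ (M p q), mul_left_comm _ (M r s), ← sum_sg_four hpq,
        Finset.mul_sum, Finset.mul_sum]
      exact Finset.sum_congr rfl fun θ _ => by ring
    simp only [h, mul_add, mul_ite, mul_one, mul_zero, Finset.sum_add_distrib,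
      ite_and, Finset.sum_ite_eq', Finset.mem_univ, if_true, Finset.sum_ite_irrel,
      Finset.sum_const_zero]
    ring
  have hexp : ∀ θ : J → Bool, (∑ p, ∑ q, M p q * (sg (θ p) * sg (θ q))) ^ 2
      = ∑ p, ∑ q, ∑ r, ∑ s,
        M p q * (sg (θ p) * sg (θ q)) * (M r s * (sg (θ r) * sg (θ s))) := by
    intro θ
    simp_rw [sq, Finset.sum_mul, Finset.mul_sum]
  simp_rw [hexp, Finset.mul_sum, ← hinner]
  rw [Finset.sum_comm]
  refine Finset.sum_congr rfl fun p _ => ?_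
  rw [Finset.sum_comm]
  refine Finset.sum_congr rfl fun q _ => ?_
  rw [Finset.sum_comm]
  refine Finset.sum_congr rfl fun r _ => ?_
  rw [Finset.sum_comm]

theorem sum_rademacher_mul (x y : J → ℝ) :
    ∑ θ : J → Bool, (∑ l, x l * sg (θ l)) * (∑ l, y l * sg (θ l))
      = (Fintype.card (J → Bool) : ℝ) * ∑ l, x l * y l := by
  have h : ∀ θ : J → Bool, (∑ l, x l * sg (θ l)) * (∑ l, y l * sg (θ l))
      = ∑ p, ∑ q, x p * y q * (sg (θ p) * sg (θ q)) := by
    intro θ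
    rw [Finset.sum_mul_sum]
    exact Finset.sum_congr rfl fun p _ => Finset.sum_congr rfl fun q _ => by ring
  simp_rw [h]
  rw [Finset.sum_comm, Finset.mul_sum]
  refine Finset.sum_congr rfl fun p _ => ?_
  rw [Finset.sum_comm]
  simp_rw [← Finset.mul_sum, sum_sg_mul_sg, mul_ite, mul_zero, Finset.sum_ite_eq, Finset.mem_univ,
    if_true]
  ring

/-- The fourth moment case of Khintchine's inequality. -/
theorem sum_rademacher_pow_four_le (x : J → ℝ) :
    ∑ θ : J → Bool, (∑ l, x l * sg (θ l)) ^ 4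
      ≤ (Fintype.card (J → Bool) : ℝ) * (3 * (∑ l, x l ^ 2) ^ 2) := by
  set s : ℝ := ∑ l, x l ^ 2 with hs
  let M : J → J → ℝ := fun p q => if p = q then 0 else x p * x q
  have hM : ∀ p, M p p = 0 := fun p => by simp [M]
  have hsq : ∀ θ : J → Bool, (∑ l, x l * sg (θ l)) ^ 2
      = s + ∑ p, ∑ q, M p q * (sg (θ p) * sg (θ q)) := by
    intro θ
    have h1 : ∀ p q, x p * sg (θ p) * (x q * sg (θ q))
        = (if p = q then x p ^ 2 else 0) + M p q * (sg (θ p) * sg (θ q)) := by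
      intro p q
      dsimp only [M]
      split_ifs with h
      · subst h
        rw [mul_mul_mul_comm, sg_mul_self]
        ring
      · ring
    rw [sq, Finset.sum_mul_sum]
    simp only [h1, Finset.sum_add_distrib, Finset.sum_ite_eq, Finset.mem_univ, if_true, hs]
  have hmean : ∑ θ : J → Bool, ∑ p, ∑ q, M p q * (sg (θ p) * sg (θ q)) = 0 := by
    rw [Finset.sum_comm]
    refine Finset.sum_eq_zero fun p _ => ?_
    rw [Finset.sum_comm]
    refine Finset.sum_eq_zero fun q _ => ?_
    rw [← Finset.mul_sum, sum_sg_mul_sg]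
    split_ifs with h
    · subst h
      simp [hM]
    · simp
  have hquad : ∑ p, ∑ q, M p q * (M p q + M q p) ≤ 2 * s ^ 2 := by
    have : 2 * s ^ 2 = ∑ p, ∑ q, 2 * (x p ^ 2 * x q ^ 2) := by
      rw [sq, hs, Finset.sum_mul_sum]
      simp only [Finset.mul_sum]
    rw [this]
    refine Finset.sum_le_sum fun p _ => Finset.sum_le_sum fun q _ => ?_
    dsimp only [M]
    split_ifs with h h' h'
    · simp; positivity
    · exact absurd h.symm h'
    · exact absurd h'.symm h
    · exact le_of_eq (by ring)
  have h4 : ∀ θ : J → Bool, (∑ l, x l * sg (θ l)) ^ 4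
      = s ^ 2 + 2 * s * (∑ p, ∑ q, M p q * (sg (θ p) * sg (θ q)))
        + (∑ p, ∑ q, M p q * (sg (θ p) * sg (θ q))) ^ 2 := by
    intro θ
    have : (∑ l, x l * sg (θ l)) ^ 4 = ((∑ l, x l * sg (θ l)) ^ 2) ^ 2 := by ring
    rw [this, hsq]
    ring
  simp only [h4, Finset.sum_add_distrib, ← Finset.mul_sum, hmean, sum_quadratic_sq M hM]
  rw [Finset.sum_const, Finset.card_univ, nsmul_eq_mul]
  have hc : (0 : ℝ) ≤ Fintype.card (J → Bool) := by positivity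
  nlinarith [mul_le_mul_of_nonneg_left hquad hc]

end Rademacher

/-! ### Grothendieck's inequality -/

section Grothendieck

variable {p q : ℕ}

theorem abs_sum_mul_le_sum_sg_mul {ι : Type*} [Fintype ι] (c : ι → ℝ) {r : ι → ℝ}
    (hr : ∀ i, |r i| ≤ 1) : |∑ i, r i * c i| ≤ ∑ i, sg (decide (0 ≤ c i)) * c i := by
  refine (Finset.abs_sum_le_sum_abs _ _).trans (Finset.sum_le_sum fun i _ => ?_)
  have : sg (decide (0 ≤ c i)) * c i = |c i| := by
    by_cases hc : 0 ≤ c i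
    · simp [sg, hc, abs_of_nonneg hc]
    · simp [sg, hc, abs_of_neg (not_le.1 hc)]
  rw [this, abs_mul]
  exact mul_le_of_le_one_left (abs_nonneg _) (hr i)

/-- A bilinear form bounded by one on sign vectors is bounded by one on the cubes. -/
theorem abs_bilin_le_of_signs {ι κ : Type*} [Fintype ι] [Fintype κ] (A : ι → κ → ℝ)
    (h : ∀ (u : ι → Bool) (v : κ → Bool), |∑ i, ∑ j, A i j * (sg (u i) * sg (v j))| ≤ 1)
    {s : ι → ℝ} {t : κ → ℝ} (hs : ∀ i, |s i| ≤ 1) (ht : ∀ j, |t j| ≤ 1) :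
    |∑ i, ∑ j, A i j * (s i * t j)| ≤ 1 := by
  have h1 := abs_sum_mul_le_sum_sg_mul (fun i => ∑ j, A i j * t j) hs
  set u : ι → Bool := fun i => decide (0 ≤ ∑ j, A i j * t j) with hu
  have h2 := abs_sum_mul_le_sum_sg_mul (fun j => ∑ i, A i j * sg (u i)) ht
  set v : κ → Bool := fun j => decide (0 ≤ ∑ i, A i j * sg (u i)) with hv
  have e1 : ∑ i, ∑ j, A i j * (s i * t j) = ∑ i, s i * ∑ j, A i j * t j := by
    simp only [Finset.mul_sum]
    exact Finset.sum_congr rfl fun i _ => Finset.sum_congr rfl fun j _ => by ring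
  have e2 : ∑ i, sg (u i) * ∑ j, A i j * t j = ∑ j, t j * ∑ i, A i j * sg (u i) := by
    simp only [Finset.mul_sum]
    rw [Finset.sum_comm]
    exact Finset.sum_congr rfl fun i _ => Finset.sum_congr rfl fun j _ => by ring
  have e3 : ∑ j, sg (v j) * ∑ i, A i j * sg (u i) = ∑ i, ∑ j, A i j * (sg (u i) * sg (v j)) := by
    simp only [Finset.mul_sum]
    rw [Finset.sum_comm]
    exact Finset.sum_congr rfl fun i _ => Finset.sum_congr rfl fun j _ => by ring
  rw [e1]
  refine h1.trans ?_
  rw [e2]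
  refine (le_abs_self _).trans (h2.trans ?_)
  rw [e3]
  exact (le_abs_self _).trans (h u v)

/-- The values of the bilinear form of `A` on vectors of Euclidean unit balls. -/
def vectorValues (A : Matrix (Fin p) (Fin q) ℝ) : Set ℝ :=
  {s | ∃ (k : ℕ) (x : Fin p → EuclideanSpace ℝ (Fin k)) (y : Fin q → EuclideanSpace ℝ (Fin k)),
    (∀ i, ‖x i‖ ≤ 1) ∧ (∀ j, ‖y j‖ ≤ 1) ∧ s = |∑ i, ∑ j, A i j * inner ℝ (x i) (y j)|}

theorem bddAbove_vectorValues (A : Matrix (Fin p) (Fin q) ℝ) : BddAbove (vectorValues A) := by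
  refine ⟨∑ i, ∑ j, |A i j|, ?_⟩
  rintro s ⟨k, x, y, hx, hy, rfl⟩
  refine (Finset.abs_sum_le_sum_abs _ _).trans (Finset.sum_le_sum fun i _ =>
    (Finset.abs_sum_le_sum_abs _ _).trans (Finset.sum_le_sum fun j _ => ?_))
  rw [abs_mul]
  refine mul_le_of_le_one_right (abs_nonneg _) ((abs_real_inner_le_norm _ _).trans ?_)
  exact mul_le_one₀ (hx i) (norm_nonneg _) (hy j)

/-- The supremum of `vectorValues` also controls functions on a finite probability space, where
the inner product is the mean of the product. -/
theorem abs_bilin_mean_le (A : Matrix (Fin p) (Fin q) ℝ) {Ξ : Type*} [Fintype Ξ] {c δ ε : ℝ}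
    (hc : 0 < c) (hδ : 0 < δ) (hε : 0 < ε) {u : Fin p → Ξ → ℝ} {v : Fin q → Ξ → ℝ}
    (hu : ∀ i, ∑ ξ, u i ξ ^ 2 ≤ c * δ ^ 2) (hv : ∀ j, ∑ ξ, v j ξ ^ 2 ≤ c * ε ^ 2) :
    |∑ i, ∑ j, A i j * ∑ ξ, u i ξ * v j ξ| ≤ c * (δ * ε * sSup (vectorValues A)) := by
  set e := Fintype.equivFin Ξ
  have hsc : 0 < √c := Real.sqrt_pos.2 hc
  let x : Fin p → EuclideanSpace ℝ (Fin (Fintype.card Ξ)) :=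
    fun i => WithLp.toLp 2 fun l => u i (e.symm l) / (√c * δ)
  let y : Fin q → EuclideanSpace ℝ (Fin (Fintype.card Ξ)) :=
    fun j => WithLp.toLp 2 fun l => v j (e.symm l) / (√c * ε)
  have hnorm : ∀ (w : Ξ → ℝ) (η : ℝ), 0 < η → ∑ ξ, w ξ ^ 2 ≤ c * η ^ 2 →
      ‖(WithLp.toLp 2 fun l => w (e.symm l) / (√c * η) :
        EuclideanSpace ℝ (Fin (Fintype.card Ξ)))‖ ≤ 1 := by
    intro w η hη hw
    rw [EuclideanSpace.norm_eq, Real.sqrt_le_iff, one_pow]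
    refine ⟨zero_le_one, ?_⟩
    simp only [Real.norm_eq_abs, sq_abs, div_pow, mul_pow, Real.sq_sqrt hc.le]
    rw [← Finset.sum_div, div_le_one (by positivity),
      Equiv.sum_comp e.symm fun ξ => w ξ ^ 2]
    exact hw
  have hin : ∀ i j, inner ℝ (x i) (y j) = (∑ ξ, u i ξ * v j ξ) / (c * (δ * ε)) := by
    intro i j
    rw [PiLp.inner_apply, Finset.sum_div,
      ← Equiv.sum_comp e.symm fun ξ => u i ξ * v j ξ / (c * (δ * ε))]
    refine Finset.sum_congr rfl fun l _ => ?_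
    simp only [x, y, RCLike.inner_apply, conj_trivial]
    rw [div_mul_div_comm]
    congr 1
    · ring
    · rw [mul_mul_mul_comm, Real.mul_self_sqrt hc.le]
      ring
  have hle := le_csSup (bddAbove_vectorValues A)
    ⟨_, x, y, fun i => hnorm _ δ hδ (hu i), fun j => hnorm _ ε hε (hv j), rfl⟩
  simp only [hin] at hle
  have : ∑ i, ∑ j, A i j * ((∑ ξ, u i ξ * v j ξ) / (c * (δ * ε)))
      = (∑ i, ∑ j, A i j * ∑ ξ, u i ξ * v j ξ) / (c * (δ * ε)) := by
    simp only [Finset.sum_div, mul_div_assoc]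
  have hpos : 0 < c * (δ * ε) := by positivity
  rw [this, abs_div, abs_of_pos hpos, div_le_iff₀ hpos] at hle
  linarith

/-- Truncation of a real number to `[-√48, √48]`. -/
noncomputable def trunc (x : ℝ) : ℝ := max (-√48) (min (√48) x)

theorem abs_trunc_le (x : ℝ) : |trunc x| ≤ √48 := by
  have h : 0 ≤ √48 := Real.sqrt_nonneg _
  rw [abs_le, trunc]
  exact ⟨le_max_left _ _, max_le (by linarith) (min_le_left _ _)⟩

theorem trunc_sq_le (x : ℝ) : trunc x ^ 2 ≤ x ^ 2 := by
  have h : 0 ≤ √48 := Real.sqrt_nonneg _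
  rw [trunc, sq_le_sq]
  rcases le_total x (-√48) with h1 | h1
  · rw [min_eq_right (by linarith), max_eq_left h1, abs_neg, abs_of_nonneg h,
      abs_of_nonpos (by linarith)]
    linarith
  rcases le_total x (√48) with h2 | h2
  · rw [min_eq_right h2, max_eq_right h1]
  · rw [min_eq_left h2, max_eq_right (by linarith), abs_of_nonneg h, abs_of_nonneg (by linarith)]
    exact h2

theorem sub_trunc_sq_le (x : ℝ) : (x - trunc x) ^ 2 ≤ x ^ 4 / 48 := by
  have h : 0 ≤ √48 := Real.sqrt_nonneg _
  have h48 : √48 ^ 2 = 48 := Real.sq_sqrt (by norm_num)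
  have hbig : ∀ y : ℝ, √48 ≤ y → (y - √48) ^ 2 ≤ y ^ 4 / 48 := by
    intro y hy
    have h1 : (y - √48) ^ 2 ≤ y ^ 2 := pow_le_pow_left₀ (by linarith) (by linarith) 2
    have h2 : 48 ≤ y ^ 2 := h48 ▸ pow_le_pow_left₀ h hy 2
    have h3 : y ^ 4 = y ^ 2 * y ^ 2 := by ring
    nlinarith [sq_nonneg y]
  rw [trunc]
  rcases le_total x (-√48) with h1 | h1
  · rw [min_eq_right (by linarith), max_eq_left h1]
    have := hbig (-x) (by linarith)
    calc (x - -√48) ^ 2 = (-x - √48) ^ 2 := by ring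
      _ ≤ (-x) ^ 4 / 48 := this
      _ = x ^ 4 / 48 := by ring
  rcases le_total x (√48) with h2 | h2
  · rw [min_eq_right h2, max_eq_right h1, sub_self, zero_pow two_ne_zero]
    positivity
  · rw [min_eq_left h2, max_eq_right (by linarith)]
    exact hbig x h2

/-- Grothendieck's inequality with the constant `96`. Vectors become Rademacher sums, which are
truncated: the truncated parts are bounded functions, and the remainders have second moment at
most `1 / 16`, so that the best bound `K` for the given matrix satisfies `K ≤ 48 + K / 2`. -/
theorem isGrothendieckBound_ninetySix : IsGrothendieckBound 96 := by
  intro p q k A hA x y hx hy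
  set K := sSup (vectorValues A) with hK
  have hmem : ∀ s ∈ vectorValues A, s ≤ 48 + K / 2 := by
    rintro s ⟨k, x, y, hx, hy, rfl⟩
    set c : ℝ := (Fintype.card (Fin k → Bool) : ℝ) with hc
    have hc0 : 0 < c := by
      rw [hc]
      exact_mod_cast Fintype.card_pos
    let X : Fin p → (Fin k → Bool) → ℝ := fun i θ => ∑ l, x i l * sg (θ l)
    let Y : Fin q → (Fin k → Bool) → ℝ := fun j θ => ∑ l, y j l * sg (θ l)
    have hin : ∀ i j, ∑ θ, X i θ * Y j θ = c * inner ℝ (x i) (y j) := by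
      intro i j
      rw [sum_rademacher_mul, PiLp.inner_apply]
      congr 1
      refine Finset.sum_congr rfl fun l _ => ?_
      simp [mul_comm]
    have hn : ∀ v : EuclideanSpace ℝ (Fin k), ‖v‖ ≤ 1 → ∑ l, v l ^ 2 ≤ 1 := by
      intro v hv
      rw [EuclideanSpace.norm_eq, Real.sqrt_le_iff] at hv
      simpa only [Real.norm_eq_abs, sq_abs, one_pow] using hv.2
    have h2 : ∀ v : EuclideanSpace ℝ (Fin k), ‖v‖ ≤ 1 →
        ∑ θ : Fin k → Bool, (∑ l, v l * sg (θ l)) ^ 2 ≤ c * 1 ^ 2 := by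
      intro v hv
      simp only [sq (∑ l, v l * sg _), sum_rademacher_mul]
      have := hn v hv
      simp only [sq] at this
      nlinarith
    have h2t : ∀ v : EuclideanSpace ℝ (Fin k), ‖v‖ ≤ 1 →
        ∑ θ : Fin k → Bool, trunc (∑ l, v l * sg (θ l)) ^ 2 ≤ c * 1 ^ 2 := fun v hv =>
      (Finset.sum_le_sum fun θ _ => trunc_sq_le _).trans (h2 v hv)
    have h2r : ∀ v : EuclideanSpace ℝ (Fin k), ‖v‖ ≤ 1 →
        ∑ θ : Fin k → Bool, ((∑ l, v l * sg (θ l)) - trunc (∑ l, v l * sg (θ l))) ^ 2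
          ≤ c * (1 / 4) ^ 2 := by
      intro v hv
      refine (Finset.sum_le_sum fun θ _ => sub_trunc_sq_le _).trans ?_
      rw [← Finset.sum_div]
      have h4 := sum_rademacher_pow_four_le (fun l => v l)
      have h5 : (∑ l, v l ^ 2) ^ 2 ≤ 1 :=
        pow_le_one₀ (Finset.sum_nonneg fun _ _ => sq_nonneg _) (hn v hv)
      have h6 := mul_le_mul_of_nonneg_left h5 hc0.le
      linarith
    have b1 : |∑ i, ∑ j, A i j * ∑ θ, trunc (X i θ) * trunc (Y j θ)| ≤ c * 48 := by
      have hswap : ∑ i, ∑ j, A i j * ∑ θ, trunc (X i θ) * trunc (Y j θ)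
          = ∑ θ, 48 * ∑ i, ∑ j, A i j * (trunc (X i θ) / √48 * (trunc (Y j θ) / √48)) := by
        have h48 : √48 * √48 = 48 := Real.mul_self_sqrt (by norm_num)
        simp only [div_mul_div_comm, h48, Finset.mul_sum]
        rw [Finset.sum_comm (s := (Finset.univ : Finset (Fin k → Bool)))]
        refine Finset.sum_congr rfl fun i _ => ?_
        rw [Finset.sum_comm (s := (Finset.univ : Finset (Fin k → Bool)))]
        exact Finset.sum_congr rfl fun j _ => Finset.sum_congr rfl fun θ _ => by ring
      rw [hswap]
      refine (Finset.abs_sum_le_sum_abs _ _).trans ?_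
      refine (Finset.sum_le_sum (g := fun _ => (48 : ℝ)) fun θ _ => ?_).trans ?_
      · rw [abs_mul, abs_of_pos (by norm_num : (0 : ℝ) < 48)]
        have hb : ∀ z : ℝ, |trunc z / √48| ≤ 1 := fun z => by
          rw [abs_div, abs_of_nonneg (Real.sqrt_nonneg _)]
          exact div_le_one_of_le₀ (abs_trunc_le z) (Real.sqrt_nonneg _)
        have := hA (fun i => trunc (X i θ) / √48) (fun j => trunc (Y j θ) / √48)
          (fun i => hb _) (fun j => hb _)
        linarith
      · rw [Finset.sum_const, Finset.card_univ, nsmul_eq_mul]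
    have b2 := abs_bilin_mean_le A hc0 one_pos (by norm_num : (0 : ℝ) < 1 / 4)
      (fun i => h2t (x i) (hx i)) (fun j => h2r (y j) (hy j))
    have b3 := abs_bilin_mean_le A hc0 (by norm_num : (0 : ℝ) < 1 / 4) one_pos
      (fun i => h2r (x i) (hx i)) (fun j => h2 (y j) (hy j))
    have hdec : c * ∑ i, ∑ j, A i j * inner ℝ (x i) (y j)
        = ∑ i, ∑ j, A i j * (∑ θ, trunc (X i θ) * trunc (Y j θ))
          + ∑ i, ∑ j, A i j * (∑ θ, trunc (X i θ) * (Y j θ - trunc (Y j θ)))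
          + ∑ i, ∑ j, A i j * (∑ θ, (X i θ - trunc (X i θ)) * Y j θ) := by
      simp only [Finset.mul_sum, ← Finset.sum_add_distrib]
      refine Finset.sum_congr rfl fun i _ => Finset.sum_congr rfl fun j _ => ?_
      rw [mul_left_comm, ← hin, Finset.mul_sum]
      exact Finset.sum_congr rfl fun θ _ => by ring
    have habs : c * |∑ i, ∑ j, A i j * inner ℝ (x i) (y j)| ≤ c * (48 + K / 2) := by
      rw [← abs_of_pos hc0, ← abs_mul, abs_of_pos hc0, hdec]
      refine (abs_add_three _ _ _).trans ?_
      linarith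
    exact le_of_mul_le_mul_left habs hc0
  have hxy := le_csSup (bddAbove_vectorValues A) ⟨k, x, y, hx, hy, rfl⟩
  have hK48 : K ≤ 48 + K / 2 := csSup_le ⟨_, k, x, y, hx, hy, rfl⟩ hmem
  linarith

theorem one_le_of_isGrothendieckBound {K : ℝ} (hK : IsGrothendieckBound K) : 1 ≤ K := by
  have h := hK 1 1 1 (fun _ _ => 1) (fun s t hs ht => by
    simpa [abs_mul] using mul_le_one₀ (hs 0) (abs_nonneg _) (ht 0))
    (fun _ => EuclideanSpace.single 0 1) (fun _ => EuclideanSpace.single 0 1)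
    (fun _ => by simp) (fun _ => by simp)
  simpa using h

theorem one_le_grothendieckConstant : 1 ≤ grothendieckConstant :=
  le_csInf ⟨96, isGrothendieckBound_ninetySix⟩ fun _ hK => one_le_of_isGrothendieckBound hK

theorem isGrothendieckBound_grothendieckConstant : IsGrothendieckBound grothendieckConstant :=
  fun p q k A hA x y hx hy =>
    le_csInf ⟨96, isGrothendieckBound_ninetySix⟩ fun _ hK => hK p q k A hA x y hx hy

end Grothendieck

/-! ### The M-norm by duality -/

section Norm

variable {d N : ℕ}

/-- The rank-one sign tensor with the sign vectors `u j`. -/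
def signOuter (u : Fin d → Fin N → Bool) : Tensor d N := outer fun j i => sg (u j i)

theorem signOuter_apply (u : Fin d → Fin N → Bool) (ω : Fin d → Fin N) :
    signOuter u ω = ∏ j, sg (u j (ω j)) := rfl

theorem signOuter_sq (u : Fin d → Fin N → Bool) (ω : Fin d → Fin N) : signOuter u ω ^ 2 = 1 := by
  rw [signOuter_apply, ← Finset.prod_pow]
  simp [sg_sq]

theorem signOuter_mem (hN : 1 ≤ N) (u : Fin d → Fin N → Bool) :
    signOuter u ∈ signTensors d N := by
  refine ⟨fun ω => by
    rw [← sq_eq_sq_iff_eq_or_eq_neg, one_pow, signOuter_sq], ?_⟩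
  have h1 : cpRank (signOuter u) ≤ 1 :=
    Nat.sInf_le ⟨fun _ j i => sg (u j i), by simp [signOuter]⟩
  have h0 : cpRank (signOuter u) ≠ 0 := by
    intro h
    rcases Nat.sInf_eq_zero.1 h with ⟨v, hv⟩ | h
    · have h2 := signOuter_sq u fun _ => ⟨0, hN⟩
      rw [hv] at h2
      simp at h2
    · have : (1 : ℕ) ∈ {r : ℕ | ∃ v : Fin r → Fin d → Fin N → ℝ,
          signOuter u = ∑ i, outer (v i)} := ⟨fun _ j i => sg (u j i), by simp [signOuter]⟩
      rw [h] at this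
      exact this
  omega

theorem exists_signOuter_eq_neg (hd : 1 ≤ d) (u : Fin d → Fin N → Bool) :
    ∃ v : Fin d → Fin N → Bool, signOuter v = -signOuter u := by
  obtain ⟨k, rfl⟩ : ∃ k, d = k + 1 := ⟨d - 1, by omega⟩
  refine ⟨Fin.cons (fun i => !u 0 i) fun j => u j.succ, ?_⟩
  ext ω
  simp [signOuter_apply, Fin.prod_univ_succ, sg_not]

theorem finite_signTensors : (signTensors d N).Finite := by
  refine (Set.Finite.pi fun _ : Fin d → Fin N => Set.toFinite ({1, -1} : Set ℝ)).subset ?_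
  intro T hT ω _
  simpa using hT.1 ω

/-- The M-norm is at most `s` if every linear functional bounded by one on rank-one sign tensors
is at most `s` at `T`, by the Hahn–Banach theorem. -/
theorem mNorm_le_of_dual (hd : 1 ≤ d) (hN : 1 ≤ N) {s : ℝ} (hs : 0 < s) (T : Tensor d N)
    (h : ∀ Φ : Tensor d N, (∀ u, |∑ ω, Φ ω * signOuter u ω| ≤ 1) → ∑ ω, Φ ω * T ω ≤ s) :
    mNorm T ≤ s := by
  refine gauge_le_of_mem hs.le ?_
  by_contra hT
  have hcl : IsClosed (s • convexHull ℝ (signTensors d N)) :=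
    (finite_signTensors.isCompact_convexHull ℝ).smul s |>.isClosed
  obtain ⟨f, c, hf, hfT⟩ := geometric_hahn_banach_closed_point
    ((convex_convexHull ℝ _).smul s) hcl hT
  have hsign : ∀ u, f (signOuter u) < c / s := by
    intro u
    have h1 := hf _ (Set.smul_mem_smul_set (a := s)
      (subset_convexHull ℝ _ (signOuter_mem hN u)))
    rw [map_smul, smul_eq_mul] at h1
    rw [lt_div_iff₀ hs]
    linarith
  have habs : ∀ u, |f (signOuter u)| < c / s := by
    intro u
    obtain ⟨v, hv⟩ := exists_signOuter_eq_neg hd u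
    have h1 := hsign v
    rw [hv, map_neg] at h1
    exact abs_lt.2 ⟨by linarith, hsign u⟩
  have hcs : 0 < c / s := (abs_nonneg _).trans_lt (habs fun _ _ => true)
  have hrep : ∀ U : Tensor d N,
      ∑ ω, f (Pi.single ω 1) / (c / s) * U ω = f U / (c / s) := by
    intro U
    have h1 := LinearMap.pi_apply_eq_sum_univ (f : Tensor d N →ₗ[ℝ] ℝ) U
    simp only [ContinuousLinearMap.coe_coe, smul_eq_mul] at h1
    rw [h1, Finset.sum_div]
    refine Finset.sum_congr rfl fun ω _ => ?_
    have h2 : (Pi.single ω 1 : Tensor d N) = fun j => if ω = j then 1 else 0 := by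
      ext j
      simp [Pi.single_apply, eq_comm]
    rw [h2]
    ring
  have hfin := h (fun ω => f (Pi.single ω 1) / (c / s)) (fun u => by
    rw [hrep, abs_div, abs_of_pos hcs, div_le_one hcs]
    exact (habs u).le)
  rw [hrep, div_le_iff₀ hcs, mul_div_cancel₀ _ hs.ne'] at hfin
  exact absurd hfT (not_lt.2 hfin)

/-- The tensor Grothendieck inequality in the form needed: after fixing sign vectors for all but
two directions, the form on the remaining two directions is bounded by the matrix inequality,
with the rows of `M` as one family of vectors and standard basis vectors as the other. -/
theorem abs_sum_rows_le {k a : ℕ} (Φ : Tensor (k + 2) N)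
    (hΦ : ∀ u, |∑ ω, Φ ω * signOuter u ω| ≤ 1) (g : Fin N → Fin a) (v : Fin k → Fin N → Bool)
    (M : Fin N → Fin a → ℝ) {ρ : ℝ} (hρ : 0 < ρ) (hM : ∀ i, ∑ j, M i j ^ 2 ≤ ρ ^ 2) :
    |∑ ω, Φ ω * (M (ω 0) (g (ω 1)) * ∏ t, sg (v t (ω t.succ.succ)))|
      ≤ grothendieckConstant * ρ := by
  let A : Matrix (Fin N) (Fin N) ℝ := fun i j =>
    ∑ ω : Fin (k + 2) → Fin N, if i = ω 0 then if j = ω 1 then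
      Φ ω * ∏ t, sg (v t (ω t.succ.succ)) else 0 else 0
  have hA : ∀ B : Fin N → Fin N → ℝ, ∑ i, ∑ j, A i j * B i j
      = ∑ ω, Φ ω * (B (ω 0) (ω 1) * ∏ t, sg (v t (ω t.succ.succ))) := by
    intro B
    simp only [A, Finset.sum_mul, ite_mul, zero_mul]
    rw [Finset.sum_congr rfl fun i _ => Finset.sum_comm, Finset.sum_comm]
    refine Finset.sum_congr rfl fun ω _ => ?_
    simp only [Finset.sum_ite_irrel, Finset.sum_const_zero, Finset.sum_ite_eq', Finset.mem_univ,
      if_true]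
    ring
  have hbox := fun s t => abs_bilin_le_of_signs (s := s) (t := t) A (fun u u' => by
    have h1 := hΦ (Fin.cons u (Fin.cons u' v))
    rw [hA fun i j => sg (u i) * sg (u' j)]
    have h2 : ∀ ω : Fin (k + 2) → Fin N, signOuter (Fin.cons u (Fin.cons u' v)) ω
        = sg (u (ω 0)) * sg (u' (ω 1)) * ∏ t, sg (v t (ω t.succ.succ)) := by
      intro ω
      rw [signOuter_apply, Fin.prod_univ_succ, Fin.prod_univ_succ, ← mul_assoc]
      rfl
    simpa only [h2] using h1)
  have hG := isGrothendieckBound_grothendieckConstant N N a A hbox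
    (fun i => WithLp.toLp 2 fun j => M i j / ρ) (fun j => EuclideanSpace.single (g j) 1)
    (fun i => by
      rw [EuclideanSpace.norm_eq, Real.sqrt_le_iff, one_pow]
      refine ⟨zero_le_one, ?_⟩
      simp only [Real.norm_eq_abs, sq_abs, div_pow]
      rw [← Finset.sum_div, div_le_one (by positivity)]
      exact hM i)
    (fun j => by simp)
  have hin : ∀ i j, inner ℝ (WithLp.toLp 2 fun l => M i l / ρ : EuclideanSpace ℝ (Fin a))
      (EuclideanSpace.single (g j) 1) = M i (g j) / ρ := by
    intro i j
    simp [EuclideanSpace.inner_single_right]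
  simp only [hin] at hG
  rw [hA fun i j => M i (g j) / ρ] at hG
  have h3 : ∑ ω, Φ ω * (M (ω 0) (g (ω 1)) / ρ * ∏ t, sg (v t (ω t.succ.succ)))
      = (∑ ω, Φ ω * (M (ω 0) (g (ω 1)) * ∏ t, sg (v t (ω t.succ.succ)))) / ρ := by
    rw [Finset.sum_div]
    exact Finset.sum_congr rfl fun ω _ => by ring
  rwa [h3, abs_div, abs_of_pos hρ, div_le_iff₀ hρ] at hG

end Norm

/-! ### Contractions of random sign tensors -/

section RandomBlocks

variable {k N a : ℕ} {Z : Fin k → Type*}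

/-- The product sign at `z` of the sign vectors `x t`, one for each of the directions `t`. -/
def prodSign (x : (Σ t, Z t) → Bool) (z : ∀ t, Z t) : ℝ := ∏ t, sg (x ⟨t, z t⟩)

theorem prodSign_mul_self (x : (Σ t, Z t) → Bool) (z : ∀ t, Z t) :
    prodSign x z * prodSign x z = 1 := by
  rw [prodSign, ← Finset.prod_mul_distrib]
  simp [sg_mul_self]

variable [∀ t, Fintype (Z t)] [∀ t, DecidableEq (Z t)]

/-- Random product signs at different indices are uncorrelated. -/
theorem sum_prodSign_mul (z z' : ∀ t, Z t) :
    ∑ x : (Σ t, Z t) → Bool, prodSign x z * prodSign x z'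
      = if z = z' then (Fintype.card ((Σ t, Z t) → Bool) : ℝ) else 0 := by
  split_ifs with h
  · subst h
    simp [prodSign_mul_self]
  · obtain ⟨t, ht⟩ := Function.ne_iff.1 h
    refine sum_eq_zero_of_flipSign ⟨t, z t⟩ fun x => ?_
    have h1 : prodSign (flipSign ⟨t, z t⟩ x) z' = prodSign x z' := by
      refine Finset.prod_congr rfl fun l _ => ?_
      rw [flipSign_of_ne]
      rintro he
      obtain ⟨rfl, h2⟩ := Sigma.mk.inj_iff.1 he
      exact ht (eq_of_heq h2).symm
    have h2 : prodSign (flipSign ⟨t, z t⟩ x) z = -prodSign x z := by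
      rw [prodSign, prodSign, ← Finset.mul_prod_erase _ _ (Finset.mem_univ t),
        ← Finset.mul_prod_erase _ _ (Finset.mem_univ t), sg_flipSign_same, neg_mul]
      congr 2
      refine Finset.prod_congr rfl fun l hl => ?_
      rw [flipSign_of_ne]
      rintro he
      exact Finset.ne_of_mem_erase hl (Sigma.mk.inj_iff.1 he).1
    rw [h1, h2, neg_mul]

/-- The matrix obtained from a sign tensor by contracting all but two directions with product
signs. -/
def contraction (θ : Fin N × Fin a × (∀ t, Z t) → Bool) (x : (Σ t, Z t) → Bool) (i : Fin N)
    (j : Fin a) : ℝ :=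
  ∑ z, sg (θ (i, j, z)) * prodSign x z

/-- A sign tensor is the mean of its contractions times the product signs. -/
theorem sum_contraction_mul (θ : Fin N × Fin a × (∀ t, Z t) → Bool) (i : Fin N) (j : Fin a)
    (z : ∀ t, Z t) :
    ∑ x, contraction θ x i j * prodSign x z
      = (Fintype.card ((Σ t, Z t) → Bool) : ℝ) * sg (θ (i, j, z)) := by
  simp only [contraction, Finset.sum_mul, mul_assoc]
  rw [Finset.sum_comm]
  simp only [← Finset.mul_sum, sum_prodSign_mul, mul_ite, mul_zero, Finset.sum_ite_eq',
    Finset.mem_univ, if_true]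
  ring

/-- The total squared deviation of the squared row lengths of a contraction from their mean. -/
def rowDeviation (θ : Fin N × Fin a × (∀ t, Z t) → Bool) (x : (Σ t, Z t) → Bool) : ℝ :=
  ∑ i, (∑ j, contraction θ x i j ^ 2 - a * (Fintype.card (∀ t, Z t) : ℝ)) ^ 2

/-- The off-diagonal part of the squared length of row `i` of a contraction is a Rademacher
quadratic form with coefficient matrix `rowForm x i`. -/
def rowForm (x : (Σ t, Z t) → Bool) (i : Fin N) (p q : Fin N × Fin a × (∀ t, Z t)) : ℝ :=
  if p.1 = i ∧ q.1 = i ∧ p.2.1 = q.2.1 ∧ p.2.2 ≠ q.2.2 then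
    prodSign x p.2.2 * prodSign x q.2.2 else 0

theorem sum_rowPairs (i : Fin N) (F : (Fin N × Fin a × (∀ t, Z t)) →
    (Fin N × Fin a × (∀ t, Z t)) → ℝ) :
    ∑ p, ∑ q, (if p.1 = i ∧ q.1 = i ∧ p.2.1 = q.2.1 ∧ p.2.2 ≠ q.2.2 then F p q else 0)
      = ∑ j, ∑ z, ∑ z', if z ≠ z' then F (i, j, z) (i, j, z') else 0 := by
  simp only [Fintype.sum_prod_type]
  rw [Finset.sum_eq_single i (fun i' _ h => by simp [h]) (by simp)]
  refine Finset.sum_congr rfl fun j _ => Finset.sum_congr rfl fun z _ => ?_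
  rw [Finset.sum_eq_single i (fun i' _ h => by simp [h]) (by simp),
    Finset.sum_eq_single j (fun j' _ h => by simp [h.symm]) (by simp)]
  simp

theorem sum_contraction_sq_sub (θ : Fin N × Fin a × (∀ t, Z t) → Bool) (x : (Σ t, Z t) → Bool)
    (i : Fin N) :
    ∑ j, contraction θ x i j ^ 2 - a * (Fintype.card (∀ t, Z t) : ℝ)
      = ∑ p, ∑ q, rowForm x i p q * (sg (θ p) * sg (θ q)) := by
  have hrow : ∀ j, contraction θ x i j ^ 2 = (Fintype.card (∀ t, Z t) : ℝ)
      + ∑ z, ∑ z', if z ≠ z' then prodSign x z * prodSign x z' *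
        (sg (θ (i, j, z)) * sg (θ (i, j, z'))) else 0 := by
    intro j
    have h1 : ∀ z z', sg (θ (i, j, z)) * prodSign x z * (sg (θ (i, j, z')) * prodSign x z')
        = (if z = z' then 1 else 0) + if z ≠ z' then prodSign x z * prodSign x z' *
          (sg (θ (i, j, z)) * sg (θ (i, j, z'))) else 0 := by
      intro z z'
      by_cases h : z = z'
      · subst h
        simp only [if_true, ne_eq, not_true_eq_false, if_false, add_zero]
        rw [mul_mul_mul_comm, sg_mul_self, prodSign_mul_self, one_mul]
      · simp only [h, ne_eq, not_false_eq_true, if_true, if_false, zero_add]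
        ring
    rw [contraction, sq, Finset.sum_mul_sum]
    simp only [h1, Finset.sum_add_distrib, Finset.sum_ite_eq, Finset.mem_univ, if_true,
      Finset.sum_const, Finset.card_univ, nsmul_eq_mul, mul_one]
  simp only [rowForm, ite_mul, zero_mul]
  rw [sum_rowPairs i fun p q => prodSign x p.2.2 * prodSign x q.2.2 * (sg (θ p) * sg (θ q))]
  simp only [hrow, Finset.sum_add_distrib, Finset.sum_const, Finset.card_univ, nsmul_eq_mul,
    Fintype.card_fin, add_sub_cancel_left]

theorem sum_rowForm (x : (Σ t, Z t) → Bool) (i : Fin N) :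
    ∑ p, ∑ q, rowForm (a := a) x i p q * (rowForm x i p q + rowForm x i q p)
      = 2 * a * ((Fintype.card (∀ t, Z t) : ℝ) * ((Fintype.card (∀ t, Z t) : ℝ) - 1)) := by
  have h : ∀ p q : Fin N × Fin a × (∀ t, Z t),
      rowForm x i p q * (rowForm x i p q + rowForm x i q p)
      = if p.1 = i ∧ q.1 = i ∧ p.2.1 = q.2.1 ∧ p.2.2 ≠ q.2.2 then 2 else 0 := by
    intro p q
    by_cases hc : p.1 = i ∧ q.1 = i ∧ p.2.1 = q.2.1 ∧ p.2.2 ≠ q.2.2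
    · have hc' : q.1 = i ∧ p.1 = i ∧ q.2.1 = p.2.1 ∧ q.2.2 ≠ p.2.2 :=
        ⟨hc.2.1, hc.1, hc.2.2.1.symm, hc.2.2.2.symm⟩
      rw [rowForm, rowForm, if_pos hc, if_pos hc', if_pos hc]
      linear_combination 2 * (prodSign x q.2.2 * prodSign x q.2.2) * prodSign_mul_self x p.2.2
        + 2 * prodSign_mul_self x q.2.2
    · rw [rowForm, if_neg hc, if_neg hc, zero_mul]
  simp only [h]
  rw [sum_rowPairs i fun _ _ => 2]
  have h2 : ∀ z z' : ∀ t, Z t, (if z ≠ z' then (2 : ℝ) else 0) = 2 - if z = z' then 2 else 0 := by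
    intro z z'
    by_cases hz : z = z' <;> simp [hz]
  simp only [h2, Finset.sum_sub_distrib, Finset.sum_const, Finset.card_univ, nsmul_eq_mul,
    Finset.sum_ite_eq, Finset.mem_univ, if_true, Fintype.card_fin]
  ring

theorem sum_rowDeviation (x : (Σ t, Z t) → Bool) :
    ∑ θ : Fin N × Fin a × (∀ t, Z t) → Bool, rowDeviation θ x
      = (Fintype.card (Fin N × Fin a × (∀ t, Z t) → Bool) : ℝ) * (N * (2 * a *
        ((Fintype.card (∀ t, Z t) : ℝ) * ((Fintype.card (∀ t, Z t) : ℝ) - 1)))) := by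
  simp only [rowDeviation, sum_contraction_sq_sub]
  rw [Finset.sum_comm]
  have h : ∀ i : Fin N, ∑ θ : Fin N × Fin a × (∀ t, Z t) → Bool,
      (∑ p, ∑ q, rowForm x i p q * (sg (θ p) * sg (θ q))) ^ 2 = _ := fun i =>
    (sum_quadratic_sq _ fun p => by simp [rowForm]).trans (by rw [sum_rowForm x i])
  simp only [h, Finset.sum_const, Finset.card_univ, Fintype.card_fin, nsmul_eq_mul]
  ring

end RandomBlocks

/-! ### Block tensors of small M-norm -/

section GoodSigns

variable {k N a : ℕ} {Z : Fin k → Type*} [∀ t, Fintype (Z t)] [∀ t, DecidableEq (Z t)]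

/-- The map onto blocks given by maps on the individual indices, the first of which is kept. -/
def blockMap (g : Fin N → Fin a) (c : ∀ t, Fin N → Z t) (ω : Fin (k + 2) → Fin N) :
    Fin N × Fin a × (∀ t, Z t) :=
  (ω 0, g (ω 1), fun t => c t (ω t.succ.succ))

/-- The sign vectors whose contractions have, on average over the product signs, rows of squared
length near the mean value. -/
noncomputable def goodSigns (N a : ℕ) (Z : Fin k → Type*) [∀ t, Fintype (Z t)]
    [∀ t, DecidableEq (Z t)] : Finset (Fin N × Fin a × (∀ t, Z t) → Bool) :=
  Finset.univ.filter fun θ => ∑ x, rowDeviation θ x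
    ≤ (Fintype.card ((Σ t, Z t) → Bool) : ℝ) * (8 * (a * (Fintype.card (∀ t, Z t) : ℝ)) ^ 2)

/-- By Markov's inequality at most a quarter of the sign vectors are not good, provided that a
contraction has as many columns as rows, or that there is nothing to contract. -/
theorem card_compl_goodSigns (hr : 0 < a * Fintype.card (∀ t, Z t))
    (hshape : a = N ∨ Fintype.card (∀ t, Z t) = 1) :
    4 * (goodSigns N a Z)ᶜ.card ≤ Fintype.card (Fin N × Fin a × (∀ t, Z t) → Bool) := by
  set n : ℝ := (Fintype.card (∀ t, Z t) : ℝ) with hn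
  set C : ℝ := (Fintype.card ((Σ t, Z t) → Bool) : ℝ) with hC
  set D : ℝ := (Fintype.card (Fin N × Fin a × (∀ t, Z t) → Bool) : ℝ) with hD
  have hC0 : 0 < C := by
    rw [hC]
    exact_mod_cast Fintype.card_pos
  have hr0 : (0 : ℝ) < a * n := by
    rw [hn]
    exact_mod_cast hr
  have hn0 : 0 ≤ n := by positivity
  have hvar : (N : ℝ) * (2 * a * (n * (n - 1))) ≤ 2 * (a * n) ^ 2 := by
    rcases hshape with h | h
    · rw [← h]
      have : 0 ≤ (a : ℝ) ^ 2 * n := by positivity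
      nlinarith
    · rw [hn, h]
      simp only [Nat.cast_one, sub_self, mul_zero]
      positivity
  have htot : ∑ θ : Fin N × Fin a × (∀ t, Z t) → Bool, ∑ x, rowDeviation θ x
      ≤ C * (D * (2 * (a * n) ^ 2)) := by
    rw [Finset.sum_comm]
    simp only [sum_rowDeviation, Finset.sum_const, Finset.card_univ, nsmul_eq_mul]
    gcongr
  have hbad : ((goodSigns N a Z)ᶜ.card : ℝ) * (C * (8 * (a * n) ^ 2))
      ≤ ∑ θ : Fin N × Fin a × (∀ t, Z t) → Bool, ∑ x, rowDeviation θ x := by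
    rw [← nsmul_eq_mul]
    refine (Finset.card_nsmul_le_sum _ _ _ fun θ hθ => ?_).trans
      (Finset.sum_le_univ_sum_of_nonneg fun θ => Finset.sum_nonneg fun x _ =>
        Finset.sum_nonneg fun i _ => sq_nonneg _)
    simp only [goodSigns, Finset.mem_compl, Finset.mem_filter, Finset.mem_univ, true_and,
      not_le] at hθ
    exact hθ.le
  have h4 : 4 * ((goodSigns N a Z)ᶜ.card : ℝ) ≤ D := by
    have hpos : 0 < C * (2 * (a * n) ^ 2) := by positivity
    refine le_of_mul_le_mul_right ?_ hpos
    linarith [hbad.trans htot]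
  rw [hD] at h4
  exact_mod_cast h4

/-- For good signs the M-norm of a block tensor is of the order of the square root of the number
of blocks per row. The tensor is the mean of its contractions times product signs, and each
contraction is a matrix to which Grothendieck's inequality applies. -/
theorem mNorm_blockTensor_le (hN : 1 ≤ N) (hr : 0 < a * Fintype.card (∀ t, Z t))
    (g : Fin N → Fin a) (c : ∀ t, Fin N → Z t) {β : ℝ} (hβ : 0 < β)
    {θ : Fin N × Fin a × (∀ t, Z t) → Bool} (hθ : θ ∈ goodSigns N a Z) :
    mNorm (blockTensor β (blockMap g c) θ)
      ≤ 2 * grothendieckConstant * β * √(a * (Fintype.card (∀ t, Z t) : ℝ)) := by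
  have hK : 0 < grothendieckConstant := zero_lt_one.trans_le one_le_grothendieckConstant
  have hr0 : (0 : ℝ) < a * (Fintype.card (∀ t, Z t) : ℝ) := by exact_mod_cast hr
  have hgood : ∑ x, rowDeviation θ x
      ≤ (Fintype.card ((Σ t, Z t) → Bool) : ℝ) * (8 * (a * (Fintype.card (∀ t, Z t) : ℝ)) ^ 2) := by
    simpa [goodSigns] using hθ
  have hdev : ∀ x i, (∑ j, contraction θ x i j ^ 2 - a * (Fintype.card (∀ t, Z t) : ℝ)) ^ 2
      ≤ rowDeviation θ x := fun x i =>
    Finset.single_le_sum (f := fun i => (∑ j, contraction θ x i j ^ 2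
      - a * (Fintype.card (∀ t, Z t) : ℝ)) ^ 2) (fun i _ => sq_nonneg _) (Finset.mem_univ i)
  have hdev0 : ∀ x, 0 ≤ rowDeviation θ x := fun x => Finset.sum_nonneg fun i _ => sq_nonneg _
  set r : ℝ := a * (Fintype.card (∀ t, Z t) : ℝ) with hrdef
  set C : ℝ := (Fintype.card ((Σ t, Z t) → Bool) : ℝ) with hC
  have hC0 : 0 < C := by
    rw [hC]
    exact_mod_cast Fintype.card_pos
  have hsr : 0 < √r := Real.sqrt_pos.2 hr0
  have hsr2 : √r ^ 2 = r := Real.sq_sqrt hr0.le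
  -- bounds the lengths of all rows; linear in the deviation, so that its mean is controlled
  let ρ : ((Σ t, Z t) → Bool) → ℝ := fun x => (13 / 2 * r + rowDeviation θ x / (6 * r)) / (4 * √r)
  have hρ : ∀ x, 0 < ρ x := fun x => by
    have := hdev0 x
    dsimp only [ρ]
    positivity
  have hrow : ∀ x i, ∑ j, contraction θ x i j ^ 2 ≤ ρ x ^ 2 := by
    intro x i
    have h1 := hdev x i
    set Δ := ∑ j, contraction θ x i j ^ 2 - r with hΔ
    have h2 : Δ ≤ rowDeviation θ x / (6 * r) + 3 / 2 * r := by
      have : Δ * (6 * r) ≤ rowDeviation θ x + 3 / 2 * r * (6 * r) := by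
        nlinarith [sq_nonneg (Δ - 3 * r)]
      have h6 : (0 : ℝ) < 6 * r := by positivity
      rw [← sub_le_iff_le_add, le_div_iff₀ h6]
      linarith
    have h3 : ρ x ^ 2 = (13 / 2 * r + rowDeviation θ x / (6 * r)) ^ 2 / (16 * r) := by
      dsimp only [ρ]
      rw [div_pow, mul_pow, hsr2]
      norm_num
    rw [h3, le_div_iff₀ (by positivity)]
    set s := rowDeviation θ x / (6 * r)
    have h4 : ∑ j, contraction θ x i j ^ 2 ≤ 5 / 2 * r + s := by linarith
    nlinarith [mul_le_mul_of_nonneg_right h4 (by positivity : (0 : ℝ) ≤ 16 * r),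
      sq_nonneg (5 / 2 * r + s - 4 * r)]
  have hmean : ∑ x, ρ x ≤ C * (2 * √r) := by
    dsimp only [ρ]
    rw [← Finset.sum_div, div_le_iff₀ (by positivity), Finset.sum_add_distrib, Finset.sum_const,
      Finset.card_univ, nsmul_eq_mul, ← Finset.sum_div, ← hC]
    have h1 : (∑ x, rowDeviation θ x) / (6 * r) ≤ C * (4 / 3 * r) := by
      rw [div_le_iff₀ (by positivity)]
      linarith
    have h2 : C * (2 * √r) * (4 * √r) = C * (8 * r) := by
      linear_combination 8 * C * hsr2
    rw [h2]
    nlinarith [mul_pos hC0 hr0]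
  refine mNorm_le_of_dual (by omega) hN (by positivity) _ fun Φ hΦ => ?_
  have hexp : C * ∑ ω, Φ ω * blockTensor β (blockMap g c) θ ω
      = ∑ x, β * ∑ ω, Φ ω * (contraction θ x (ω 0) (g (ω 1))
        * ∏ t, sg (x ⟨t, c t (ω t.succ.succ)⟩)) := by
    simp only [Finset.mul_sum]
    rw [Finset.sum_comm]
    refine Finset.sum_congr rfl fun ω _ => ?_
    have h1 := sum_contraction_mul θ (ω 0) (g (ω 1)) fun t => c t (ω t.succ.succ)
    calc C * (Φ ω * blockTensor β (blockMap g c) θ ω)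
        = β * Φ ω * (C * sg (θ (ω 0, g (ω 1), fun t => c t (ω t.succ.succ)))) := by
          rw [blockTensor, blockMap]
          ring
      _ = _ := by
          rw [← h1, Finset.mul_sum]
          refine Finset.sum_congr rfl fun x _ => ?_
          rw [prodSign]
          ring
  refine le_of_mul_le_mul_left ?_ hC0
  rw [hexp]
  calc ∑ x, β * ∑ ω, Φ ω * (contraction θ x (ω 0) (g (ω 1))
        * ∏ t, sg (x ⟨t, c t (ω t.succ.succ)⟩))
      ≤ ∑ x, β * (grothendieckConstant * ρ x) := by
        gcongr with x _
        exact (le_abs_self _).trans (abs_sum_rows_le Φ hΦ g (fun t i => x ⟨t, c t i⟩)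
          (contraction θ x) (hρ x) (hrow x))
    _ = β * grothendieckConstant * ∑ x, ρ x := by
        rw [Finset.mul_sum]
        exact Finset.sum_congr rfl fun x _ => by ring
    _ ≤ β * grothendieckConstant * (C * (2 * √r)) := by gcongr
    _ = C * (2 * grothendieckConstant * β * √r) := by ring

end GoodSigns

/-! ### Block maps with small fibres -/

section Fibres

variable {d N : ℕ}

theorem card_fibre_pi {τ : Fin d → Type*} [∀ t, DecidableEq (τ t)] (F : ∀ t, Fin N → τ t)
    (ω : Fin d → Fin N) :
    (Finset.univ.filter fun ω' : Fin d → Fin N => ∀ t, F t (ω' t) = F t (ω t)).card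
      = ∏ t, (Finset.univ.filter fun i => F t i = F t (ω t)).card := by
  rw [← Fintype.card_piFinset]
  congr 1
  ext ω'
  simp

/-- Reduction of an index modulo `b`. -/
def modMap (N : ℕ) {b : ℕ} (hb : 1 ≤ b) (i : Fin N) : Fin b := ⟨i % b, Nat.mod_lt _ hb⟩

theorem card_fibre_modMap (N : ℕ) {b : ℕ} (hb : 1 ≤ b) (z : Fin b) :
    (Finset.univ.filter fun i => modMap N hb i = z).card ≤ (N - 1) / b + 1 := by
  rw [← Finset.card_range ((N - 1) / b + 1)]
  refine Finset.card_le_card_of_injOn (fun i => (i : ℕ) / b) ?_ ?_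
  · intro i _
    have := i.isLt
    simp only [Finset.coe_range, Set.mem_Iio]
    exact Nat.lt_succ_of_le (Nat.div_le_div_right (by omega))
  · intro i hi j hj hij
    simp only [Finset.coe_filter, Finset.mem_univ, true_and, Set.mem_ofPred_eq] at hi hj
    have h1 : (i : ℕ) % b = j % b := congrArg Fin.val (hi.trans hj.symm)
    have h2 : (i : ℕ) / b = j / b := hij
    ext
    rw [← Nat.div_add_mod (i : ℕ) b, ← Nat.div_add_mod (j : ℕ) b, h1, h2]

/-- Block counts `a, b₀, …` for the last `k + 1` indices whose product matches a given number up
to a factor two. Only one of them is strictly between `1` and `N`, so that the blocks have almost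
equal sizes. -/
theorem exists_block_counts (hN : 1 ≤ N) (k : ℕ) {ρ : ℝ} (h1 : 1 ≤ ρ)
    (h2 : ρ ≤ (N : ℝ) ^ (k + 1)) :
    ∃ (a : ℕ) (b : Fin k → ℕ), 1 ≤ a ∧ (∀ t, 1 ≤ b t) ∧ ρ ≤ ((a * ∏ t, b t : ℕ) : ℝ) ∧
      ((a * ∏ t, b t : ℕ) : ℝ) ≤ 2 * ρ ∧ (a = N ∨ ∏ t, b t = 1) ∧
      a * ((N - 1) / a + 1) * ∏ t, b t * ((N - 1) / b t + 1) ≤ 2 * N ^ (k + 1) := by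
  have hdivN : (N - 1) / N = 0 := Nat.div_eq_of_lt (by omega)
  have small : ∀ (k : ℕ) (ρ : ℝ), 1 ≤ ρ → ρ ≤ N →
      ∃ (a : ℕ) (b : Fin k → ℕ), 1 ≤ a ∧ (∀ t, 1 ≤ b t) ∧ ρ ≤ ((a * ∏ t, b t : ℕ) : ℝ) ∧
      ((a * ∏ t, b t : ℕ) : ℝ) ≤ 2 * ρ ∧ (a = N ∨ ∏ t, b t = 1) ∧
      a * ((N - 1) / a + 1) * ∏ t, b t * ((N - 1) / b t + 1) ≤ 2 * N ^ (k + 1) := by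
    intro k ρ h1 h2
    have hceil : ⌈ρ⌉₊ ≤ N := Nat.ceil_le.2 h2
    refine ⟨⌈ρ⌉₊, fun _ => 1, Nat.ceil_pos.2 (by linarith), fun _ => le_rfl, ?_, ?_,
      Or.inr (by simp), ?_⟩
    · simpa using Nat.le_ceil ρ
    · have := Nat.ceil_lt_add_one (by linarith : 0 ≤ ρ)
      simp only [Finset.prod_const_one, mul_one]
      linarith
    · have h3 := Nat.mul_div_le (N - 1) ⌈ρ⌉₊
      have h4 : ⌈ρ⌉₊ * ((N - 1) / ⌈ρ⌉₊ + 1) ≤ 2 * N := by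
        rw [mul_add, mul_one]
        omega
      have h5 : ∏ _t : Fin k, 1 * ((N - 1) / 1 + 1) = N ^ k := by
        rw [Finset.prod_const, Finset.card_univ, Fintype.card_fin, one_mul, Nat.div_one,
          Nat.sub_add_cancel hN]
      rw [h5, pow_succ', ← mul_assoc]
      exact Nat.mul_le_mul_right _ h4
  induction k generalizing ρ with
  | zero => exact small 0 ρ h1 (by simpa using h2)
  | succ k ih =>
    by_cases hle : ρ ≤ N
    · exact small (k + 1) ρ h1 hle
    have hN0 : (0 : ℝ) < N := by exact_mod_cast hN
    obtain ⟨a, b, ha, hb, hlow, hup, -, hprod⟩ := ih (ρ := ρ / N)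
      ((one_le_div hN0).2 (not_le.1 hle).le) (by
        rw [div_le_iff₀ hN0, ← pow_succ]
        exact h2)
    refine ⟨N, Fin.cons a b, hN, ?_, ?_, ?_, Or.inl rfl, ?_⟩
    · intro t
      refine Fin.cases ?_ (fun t => ?_) t
      · exact ha
      · exact hb t
    · rw [div_le_iff₀ hN0] at hlow
      rw [Fin.prod_univ_succ, Fin.cons_zero, Nat.cast_mul]
      simp only [Fin.cons_succ]
      linarith
    · rw [← mul_div_assoc, le_div_iff₀ hN0] at hup
      rw [Fin.prod_univ_succ, Fin.cons_zero, Nat.cast_mul]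
      simp only [Fin.cons_succ]
      linarith
    · rw [Fin.prod_univ_succ, Fin.cons_zero, hdivN, zero_add, mul_one, pow_succ' N (k + 1),
        mul_left_comm 2]
      simp only [Fin.cons_succ]
      exact Nat.mul_le_mul_left N hprod

end Fibres

/-! ### The minimax lower bound -/

variable {N : ℕ}

theorem mNorm_blockTensor_first_le {k : ℕ} (hN : 1 ≤ N) {β : ℝ} (hβ : 0 < β) (θ : Fin N → Bool) :
    mNorm (blockTensor β (fun ω : Fin (k + 1) → Fin N => ω 0) θ) ≤ β := by
  refine mNorm_le_of_dual (by omega) hN hβ _ fun Φ hΦ => ?_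
  have h1 := hΦ (Fin.cons θ fun _ _ => true)
  have h2 : ∀ ω : Fin (k + 1) → Fin N,
      signOuter (Fin.cons θ fun _ _ => true) ω = sg (θ (ω 0)) := by
    intro ω
    rw [signOuter_apply, Fin.prod_univ_succ]
    simp [sg]
  simp only [h2] at h1
  have h3 : ∑ ω, Φ ω * blockTensor β (fun ω : Fin (k + 1) → Fin N => ω 0) θ ω
      = β * ∑ ω, Φ ω * sg (θ (ω 0)) := by
    rw [Finset.mul_sum]
    exact Finset.sum_congr rfl fun ω _ => by rw [blockTensor]; ring
  rw [h3]
  exact mul_le_of_le_one_right hβ.le ((le_abs_self _).trans h1)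

theorem abs_blockTensor_le {d : ℕ} {J : Type*} {β α : ℝ} (hβ : 0 ≤ β) (hβα : β ≤ α)
    (f : (Fin d → Fin N) → J) (θ : J → Bool) (ω : Fin d → Fin N) :
    |blockTensor β f θ ω| ≤ α := by
  rwa [blockTensor, abs_mul, abs_sg, mul_one, abs_of_nonneg hβ]

theorem card_fibre_first {k : ℕ} (ω : Fin (k + 1) → Fin N) :
    (Finset.univ.filter fun ω' : Fin (k + 1) → Fin N => ω' 0 = ω 0).card = N ^ k := by
  have h := card_fibre_pi (N := N) (τ := fun _ : Fin (k + 1) => Option (Fin N))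
    (Fin.cons some fun _ _ => none) ω
  rw [Fin.prod_univ_succ] at h
  simpa [Fin.forall_fin_succ, Finset.filter_eq'] using h

/-- Tensors that depend on the first index only give the lower bound when the noise is large, and
for vectors at any noise level. -/
theorem le_minimaxRisk_of_first {k m : ℕ} (P : PMF (Fin (k + 1) → Fin N)) {σ : ℝ} (hσ : 0 < σ)
    (hN : 2 ≤ N) (hmN : m ≤ N ^ (k + 1)) {α R β : ℝ} (hβ : 0 < β) (hβα : β ≤ α) (hβR : β ≤ R)
    (h : (m : ℝ) * β ^ 2 ≤ N * (σ ^ 2 / 2) ∨ k = 0) :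
    ENNReal.ofReal (β ^ 2 / 8) ≤ minimaxRisk m P σ (boundedMSet (k + 1) N α R) := by
  have hN0 : (0 : ℝ) < N := by exact_mod_cast (by omega : 0 < N)
  refine le_minimaxRisk_of_blocks P hσ hN (by omega) hmN β (fun ω => ω 0) Finset.univ (by simp)
    (fun θ _ => ⟨abs_blockTensor_le hβ.le hβα _ θ,
      (mNorm_blockTensor_first_le (by omega) hβ θ).trans hβR⟩) (w := 1 / N) ?_ ?_ ?_
  · rw [div_le_one hN0]
    exact_mod_cast (by omega : 1 ≤ N)
  · intro ω
    rw [card_fibre_first, Nat.cast_pow, pow_succ']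
    field_simp
    exact le_rfl
  · refine h.imp (fun h => ?_) fun h => by rw [h, zero_add, pow_one]
    rw [mul_one_div, div_mul_eq_mul_div, div_le_iff₀ hN0]
    linarith

theorem card_fibre_blockMap_le {k a : ℕ} {b : Fin k → ℕ} (ha : 1 ≤ a) (hb : ∀ t, 1 ≤ b t)
    (ω : Fin (k + 2) → Fin N) :
    (Finset.univ.filter fun ω' => blockMap (modMap N ha) (fun t => modMap N (hb t)) ω'
      = blockMap (modMap N ha) (fun t => modMap N (hb t)) ω).card
      ≤ ((N - 1) / a + 1) * ∏ t, ((N - 1) / b t + 1) := by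
  let F : Fin (k + 2) → Fin N → ℕ :=
    Fin.cons Fin.val (Fin.cons (fun i => i.val % a) fun t i => i.val % b t)
  have h := card_fibre_pi (τ := fun _ => ℕ) F ω
  rw [Fin.prod_univ_succ, Fin.prod_univ_succ] at h
  have h0 : (Finset.univ.filter fun i => F 0 i = F 0 (ω 0)).card = 1 := by
    simp [F, Fin.val_inj, Finset.filter_eq']
  have h1 : (Finset.univ.filter fun i => F (Fin.succ 0) i = F (Fin.succ 0) (ω (Fin.succ 0))).card
      ≤ (N - 1) / a + 1 := by
    refine le_trans (le_of_eq ?_) (card_fibre_modMap N ha (modMap N ha (ω 1)))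
    congr 1
    ext i
    simp [F, modMap]
  have h2 : ∀ t : Fin k, (Finset.univ.filter fun i =>
      F t.succ.succ i = F t.succ.succ (ω t.succ.succ)).card ≤ (N - 1) / b t + 1 := by
    intro t
    refine le_trans (le_of_eq ?_) (card_fibre_modMap N (hb t) (modMap N (hb t) (ω t.succ.succ)))
    congr 1
    ext i
    simp [F, modMap]
  have hset : (Finset.univ.filter fun ω' => blockMap (modMap N ha) (fun t => modMap N (hb t)) ω'
      = blockMap (modMap N ha) (fun t => modMap N (hb t)) ω)
      = Finset.univ.filter fun ω' : Fin (k + 2) → Fin N => ∀ t, F t (ω' t) = F t (ω t) := by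
    ext ω'
    simp only [Finset.mem_filter, Finset.mem_univ, true_and, blockMap, Prod.mk.injEq,
      funext_iff, Fin.forall_fin_succ (n := k + 1), Fin.forall_fin_succ (n := k)]
    simp [F, modMap, Fin.val_inj]
  rw [hset, h, h0, one_mul]
  exact Nat.mul_le_mul h1 (Finset.prod_le_prod' fun t _ => h2 t)

/-- Random block tensors with `a` blocks in the second direction and `b t` in the remaining ones
give the lower bound `β² / 8` whenever their M-norm `2 K_G β √r`, with `r = a ∏ b t`, is allowed. -/
theorem le_minimaxRisk_of_blockMap {k m a : ℕ} {b : Fin k → ℕ} (P : PMF (Fin (k + 2) → Fin N))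
    {σ : ℝ} (hσ : 0 < σ) (hN : 2 ≤ N) (hmN : m ≤ N ^ (k + 2)) (ha : 1 ≤ a) (hb : ∀ t, 1 ≤ b t)
    (hshape : a = N ∨ ∏ t, b t = 1) {α R β : ℝ} (hβ : 0 < β) (hβα : β ≤ α)
    (hβR : 2 * grothendieckConstant * β * √((a * ∏ t, b t : ℕ) : ℝ) ≤ R) {w : ℝ} (hw1 : w ≤ 1)
    (hw : ((((N - 1) / a + 1) * ∏ t, ((N - 1) / b t + 1) : ℕ) : ℝ) ≤ w * (N : ℝ) ^ (k + 2))
    (h : (m : ℝ) * w * β ^ 2 ≤ σ ^ 2 / 2 ∨ w = 1 / (N : ℝ) ^ (k + 2)) :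
    ENNReal.ofReal (β ^ 2 / 8) ≤ minimaxRisk m P σ (boundedMSet (k + 2) N α R) := by
  have hn : Fintype.card (∀ t, Fin (b t)) = ∏ t, b t := by simp
  have hr : 0 < a * Fintype.card (∀ t, Fin (b t)) := by
    rw [hn]
    exact Nat.mul_pos ha (Finset.prod_pos fun t _ => hb t)
  refine le_minimaxRisk_of_blocks P hσ hN (by omega) hmN β
    (blockMap (modMap N ha) fun t => modMap N (hb t)) (goodSigns N a fun t => Fin (b t))
    (card_compl_goodSigns hr (by rwa [hn])) (fun θ hθ => ⟨abs_blockTensor_le hβ.le hβα _ θ, ?_⟩)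
    hw1 (fun ω => le_trans ?_ hw) h
  · refine (mNorm_blockTensor_le (by omega) hr _ _ hβ hθ).trans ?_
    rw [hn, ← Nat.cast_mul]
    exact hβR
  · exact_mod_cast card_fibre_blockMap_le ha hb ω

theorem le_min_sq_div_eight {α γ τ : ℝ} (h1 : τ ≤ α ^ 2 / 16) (h2 : τ ≤ γ ^ 2 / 8) :
    τ ≤ min α γ ^ 2 / 8 := by
  rcases min_choice α γ with h | h <;> rw [h]
  · linarith [sq_nonneg α]
  · exact h2

/-- The minimax bound with better constants and without `L`. With `Q = σ √(N / m)` and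
`ρ = R / (K_G Q)`, the number `r` of blocks per row is `1` if `ρ ≤ 1` or `d = 1`, between
`ρ` and `2 ρ` if `1 < ρ ≤ Nᵈ⁻¹`, and `Nᵈ⁻¹` if `ρ` is larger. -/
theorem le_minimaxRisk (d N m : ℕ) (hd : 1 ≤ d) (hN : 2 ≤ N) (hm : 1 ≤ m)
    (hmN : m ≤ N ^ d) (α R σ : ℝ) (hα : 0 < α) (hαR : α ≤ R) (hσ : 0 < σ)
    (P : PMF (Fin d → Fin N)) {τ : ℝ} (h1 : τ ≤ α ^ 2 / 16)
    (h2 : τ ≤ σ * R / (64 * grothendieckConstant) * √((N : ℝ) / m)) :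
    ENNReal.ofReal τ ≤ minimaxRisk m P σ (boundedMSet d N α R) := by
  set K := grothendieckConstant with hKdef
  have hK : 0 < K := zero_lt_one.trans_le one_le_grothendieckConstant
  have hR : 0 < R := hα.trans_le hαR
  have hN0 : (0 : ℝ) < N := by exact_mod_cast (by omega : 0 < N)
  have hN2 : (2 : ℝ) ≤ N := by exact_mod_cast hN
  have hm0 : (0 : ℝ) < m := by exact_mod_cast hm
  -- the noise level for `N` unknown parameters
  set Q := σ * √((N : ℝ) / m) with hQ
  have hQ0 : 0 < Q := by positivity
  have hQ2 : m * Q ^ 2 = N * σ ^ 2 := by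
    rw [hQ, mul_pow, Real.sq_sqrt (by positivity)]
    field_simp
  have h2' : τ ≤ R * Q / (64 * K) := by
    refine h2.trans (le_of_eq ?_)
    rw [hQ]
    ring
  set ρ := R / (K * Q) with hρ
  have hρ0 : 0 < ρ := by positivity
  have hRρ : R = ρ * (K * Q) := by
    rw [hρ]
    field_simp
  obtain ⟨k, rfl⟩ : ∃ k, d = k + 1 := ⟨d - 1, by omega⟩
  rcases le_or_gt ρ 1 with hρ1 | hρ1
  · -- large noise
    have hs : 0 < √2 := by positivity
    have hs2 : √2 ^ 2 = 2 := Real.sq_sqrt (by norm_num)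
    refine (ENNReal.ofReal_le_ofReal (le_min_sq_div_eight h1 (γ := Q / √2) ?_)).trans
      (le_minimaxRisk_of_first P hσ hN hmN (by positivity) (min_le_left _ _)
        ((min_le_left _ _).trans hαR) (Or.inl ?_))
    · refine h2'.trans ?_
      rw [div_pow, hs2, hRρ, div_le_iff₀ (by positivity)]
      have : ρ * (K * Q) * Q ≤ 1 * (K * Q) * Q := by gcongr
      nlinarith [mul_pos (mul_pos hK hQ0) hQ0]
    · have : min α (Q / √2) ^ 2 ≤ (Q / √2) ^ 2 :=
        pow_le_pow_left₀ (by positivity) (min_le_right _ _) 2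
      rw [div_pow, hs2] at this
      nlinarith
  rcases Nat.eq_zero_or_pos k with rfl | hk
  · -- for vectors the M-norm is the maximum norm, and a fraction of the entries is never observed
    refine (ENNReal.ofReal_le_ofReal ?_).trans
      (le_minimaxRisk_of_first P hσ hN hmN hα le_rfl hαR (Or.inr rfl))
    linarith [sq_nonneg α]
  obtain ⟨k, rfl⟩ : ∃ l, k = l + 1 := ⟨k - 1, by omega⟩
  -- the M-norm constraint for block tensors with `r` blocks per row
  have hβR : ∀ r : ℝ, 0 < r → 2 * K * min α (R / (2 * K * √r)) * √r ≤ R := by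
    intro r hr
    have hsr : 0 < √r := Real.sqrt_pos.2 hr
    calc 2 * K * min α (R / (2 * K * √r)) * √r ≤ 2 * K * (R / (2 * K * √r)) * √r := by
          gcongr
          exact min_le_right _ _
      _ = R := by field_simp
  have hγ : ∀ r : ℝ, 0 < r → (R / (2 * K * √r)) ^ 2 = R ^ 2 / (4 * K ^ 2 * r) := by
    intro r hr
    rw [div_pow, mul_pow, mul_pow, Real.sq_sqrt hr.le]
    norm_num
  have hrate : ∀ r : ℝ, 0 < r → r ≤ 2 * ρ → τ ≤ (R / (2 * K * √r)) ^ 2 / 8 := by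
    intro r hr hr2
    refine h2'.trans ?_
    rw [hγ r hr, div_div, div_le_div_iff₀ (by positivity) (by positivity)]
    have e : R * Q * (4 * K ^ 2 * r * 8) = 32 * R * K * (r * (K * Q)) := by ring
    have e2 : R ^ 2 * (64 * K) = 32 * R * K * (2 * R) := by ring
    rw [e, e2]
    refine mul_le_mul_of_nonneg_left ?_ (by positivity)
    calc r * (K * Q) ≤ 2 * ρ * (K * Q) := by gcongr
      _ = 2 * R := by rw [hRρ]; ring
  rcases le_or_gt ρ ((N : ℝ) ^ (k + 1)) with hρN | hρN
  · -- `r` is chosen to balance the size of the blocks against the noise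
    obtain ⟨a, b, ha, hb, hlow, hup, hshape, hprod⟩ :=
      exists_block_counts (by omega : 1 ≤ N) k hρ1.le hρN
    set r : ℝ := ((a * ∏ t, b t : ℕ) : ℝ) with hr
    have hr1 : 1 ≤ r := hρ1.le.trans hlow
    have hr0 : 0 < r := by linarith
    refine (ENNReal.ofReal_le_ofReal (le_min_sq_div_eight h1 (hrate r hr0 hup))).trans
      (le_minimaxRisk_of_blockMap (w := 2 / (N * r)) P hσ hN hmN ha hb hshape (by positivity)
        (min_le_left _ _) (hβR r hr0) ?_ ?_ (Or.inl ?_))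
    · rw [div_le_one (by positivity)]
      nlinarith
    · have h3 : ((((N - 1) / a + 1) * ∏ t, ((N - 1) / b t + 1) : ℕ) : ℝ) * r
          ≤ 2 * (N : ℝ) ^ (k + 1) := by
        rw [hr]
        have : (((N - 1) / a + 1) * ∏ t, ((N - 1) / b t + 1)) * (a * ∏ t, b t)
            ≤ 2 * N ^ (k + 1) := by
          refine le_trans (le_of_eq ?_) hprod
          rw [Finset.prod_mul_distrib]
          ring
        exact_mod_cast this
      rw [div_mul_eq_mul_div, le_div_iff₀ (by positivity), pow_succ' _ (k + 1)]
      nlinarith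
    · have h3 : min α (R / (2 * K * √r)) ^ 2 ≤ R ^ 2 / (4 * K ^ 2 * r) := by
        rw [← hγ r hr0]
        exact pow_le_pow_left₀ (by positivity) (min_le_right _ _) 2
      have h4 : R ^ 2 / (4 * K ^ 2 * r) ≤ Q ^ 2 * r / 4 := by
        rw [hRρ, div_le_div_iff₀ (by positivity) (by norm_num)]
        have h5 : ρ ^ 2 ≤ r ^ 2 := pow_le_pow_left₀ hρ0.le hlow 2
        have h6 : (0 : ℝ) ≤ 4 * (K * Q) ^ 2 := by positivity
        nlinarith [mul_le_mul_of_nonneg_left h5 h6]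
      calc (m : ℝ) * (2 / (N * r)) * min α (R / (2 * K * √r)) ^ 2
          ≤ m * (2 / (N * r)) * (Q ^ 2 * r / 4) := by
            gcongr
            exact h3.trans h4
        _ = m * Q ^ 2 / (2 * N) := by field_simp; ring
        _ = σ ^ 2 / 2 := by rw [hQ2]; field_simp
  · -- all entries are free parameters, and a fraction of them is never observed
    have hr : ((N * ∏ _t : Fin k, N : ℕ) : ℝ) = (N : ℝ) ^ (k + 1) := by
      simp [pow_succ']
    have hr0 : (0 : ℝ) < (N : ℝ) ^ (k + 1) := by positivity
    refine (ENNReal.ofReal_le_ofReal (le_min_sq_div_eight h1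
      (hrate ((N : ℝ) ^ (k + 1)) hr0 (by linarith)))).trans
      (le_minimaxRisk_of_blockMap (a := N) (b := fun _ => N) (w := 1 / (N : ℝ) ^ (k + 2)) P hσ hN
        hmN (by omega) (fun _ => by omega) (Or.inl rfl) (by positivity) (min_le_left _ _)
        (by rw [hr]; exact hβR _ hr0) ?_ ?_ (Or.inr rfl))
    · rw [div_le_one (by positivity)]
      exact one_le_pow₀ (by linarith)
    · have h0 : (N - 1) / N = 0 := Nat.div_eq_of_lt (by omega)
      rw [h0, div_mul_cancel₀ _ (by positivity)]
      simp

end TensorCompletion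

theorem mainTheorem4 (d N m : ℕ) (hd : 1 ≤ d) (hN : 2 ≤ N) (hm : 1 ≤ m) (hmN : m ≤ N ^ d)
    (α R σ L : ℝ) (hα : 0 < α) (hαR : α ≤ R) (hσ : 0 < σ)
    (P : PMF (Fin d → Fin N)) (hP : ∀ ω, (P ω).toReal ≤ L / (N : ℝ) ^ d)
    (hR : 48 * α ^ 2 * TensorCompletion.grothendieckConstant ^ 2 / (N : ℝ) ≤ R ^ 2) :
    ENNReal.ofReal
        (min (α ^ 2 / 16)
          (σ * R / (128 * Real.sqrt 2 * TensorCompletion.grothendieckConstant) *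
            Real.sqrt ((N : ℝ) / ((m : ℝ) * L)))) ≤
      TensorCompletion.minimaxRisk m P σ (TensorCompletion.boundedMSet d N α R) := by
  have hK : 0 < TensorCompletion.grothendieckConstant :=
    zero_lt_one.trans_le TensorCompletion.one_le_grothendieckConstant
  have hR0 : 0 < R := hα.trans_le hαR
  have hN0 : (0 : ℝ) < N := by exact_mod_cast (by omega : 0 < N)
  have hm0 : (0 : ℝ) < m := by exact_mod_cast hm
  -- a probability vector on `Nᵈ` points has an entry at least `N⁻ᵈ`
  have hL : 1 ≤ L := by
    calc (1 : ℝ) = ∑ ω, (P ω).toReal := (TensorCompletion.sum_toReal_eq_one P).symm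
      _ ≤ ∑ _ω : Fin d → Fin N, L / (N : ℝ) ^ d := Finset.sum_le_sum fun ω _ => hP ω
      _ = L := by
        rw [Finset.sum_const, Finset.card_univ, nsmul_eq_mul]
        simp only [Fintype.card_pi, Fintype.card_fin, Finset.prod_const, Finset.card_univ,
          Nat.cast_pow]
        field_simp
  refine TensorCompletion.le_minimaxRisk d N m hd hN hm hmN α R σ hα hαR hσ P (min_le_left _ _)
    ((min_le_right _ _).trans ?_)
  have hs : 1 ≤ Real.sqrt 2 := Real.one_le_sqrt.2 (by norm_num)
  gcongr
  · linarith
  · exact le_mul_of_one_le_right hm0.le hL
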